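/- Let $S=K[x_1,\dots,x_n]$ be the standard graded polynomial ring over a field $K$ and $\mathfrak m=(x_1,\dots,x_n)$. For an ideal $I\subseteq S$ and $k\ge 0$ put $I^{(k)}=\bigcap_{P\in\mathrm{Ass}(S/I)}(I^kS_P\cap S)$, let $\mathcal G(I)$ be the set of minimal monomial generators of a monomial ideal $I$, and let $\omega(I)=\max\{d:(I/\mathfrak mI)_d\neq0\}$. If $\bigoplus_j S(-a_{ij})$, $i\ge0$, are the modules in the minimal graded free resolution of $I$, then $\mathrm{reg}\,I=\max_{i,j}\{a_{ij}-i\}$, and $I$ has a linear resolution if there is a $c$ with $a_{ij}=c+i$ for all $i,j$; $I$ has linear powers if $I^k$ has a linear resolution for all $k\ge1$. (The maximum of the empty set is $-\infty$; this concerns only $I=0$.) For a monomial ideal $I$ the symbolic Rees algebra $\mathcal R_s(I)=\bigoplus_{k\ge0}I^{(k)}t^k\subseteq S[t]$ is generated over $K$ by its minimal monomial generators $x_1,\dots,x_n,u_1t^{q_1},\dots,u_mt^{q_m}$, where $u_s\in S$ are monomials and $q_s>0$. Let $T=K[x_1,\dots,x_n,y_1,\dots,y_m]$ with $\mathrm{bideg}(x_i)=(1,0)$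 and $\mathrm{bideg}(y_s)=(\deg u_s,q_s)$, and regard $\mathcal R_s(I)$ as a bigraded $T$-module through $x_i\mapsto x_i$, $y_s\mapsto u_st^{q_s}$, where $ft^b$ has bidegree $(a,b)$ if $f$ is homogeneous of degree $a$. If $\bigoplus_jT(-a_{ij},-b_{ij})$, $i\ge0$, are the modules in its minimal bigraded free $T$-resolution, put $\mathrm{reg}_x\mathcal R_s(I)=\max_{i,j}\{a_{ij}-i\}$. For $k\ge1$ let $d(I,k)=\max\{\sum_{s=1}^m c_s\deg(u_s): c\in\mathbb Z_{\ge0}^m,\ \sum_{s=1}^m c_sq_s\le k\}$. **Theorem.** Let $I\subseteq S$ be a monomial ideal of minimal intersection type, that is, $I$ is a finite intersection of powers of monomial prime ideals and has no embedded associated primes. Then: (a) $u^k\in\mathcal G(I^{(k)})$ for all $u\in\mathcal G(I)$ and all $k\ge1$. (b) $\mathrm{reg}\,I^{(k)}\ge\omega(I^{(k)})\ge\omega(I)k$ for all $k\ge1$. (c) If $I$ has linear powers, then $\mathrm{reg}\,I^{(k)}\ge\mathrm{reg}\,I^k$ for all $k\ge1$. (d) If $I$ has linear powers, $\mathrm{reg}_x\mathcal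 R_s(I)=0$ and $d(I,k)=\omega(I)k$ for all $k\ge1$, then $\mathrm{reg}\,I^{(k)}=\mathrm{reg}\,I^k$ for all $k\ge1$. -/

import Mathlib

noncomputable section

namespace SymbolicReg

open MvPolynomial

/-! ## Graded free resolutions over a polynomial ring -/

/-- Let `R = K[x_s : s ∈ σ]` be graded by an abelian group `A` with `deg x_s = w s`, and let `M` be
an `A`-graded `R`-module, `𝓜 a` being the set of homogeneous elements of `M` of degree `a`.
A graded free resolution `⋯ → F₁ → F₀ → M → 0` of `M`, where `F_i = ⨁_j R(-shift i j)` is a free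
module of finite rank whose `j`-th basis element is homogeneous of degree `shift i j`, and all maps
are homogeneous of degree zero. -/
structure GradedFreeResolution {K σ A M : Type*} [Field K] [AddCommGroup A] (w : σ → A)
    [AddCommGroup M] [Module (MvPolynomial σ K) M] (𝓜 : A → Set M) where
  rank : ℕ → ℕ
  shift : ∀ i, Fin (rank i) → A
  d : ∀ i, (Fin (rank (i + 1)) → MvPolynomial σ K) →ₗ[MvPolynomial σ K]
    (Fin (rank i) → MvPolynomial σ K)
  ε : (Fin (rank 0) → MvPolynomial σ K) →ₗ[MvPolynomial σ K] M
  d_homogeneous : ∀ i j j',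
    IsWeightedHomogeneous w (d i (Pi.single j 1) j') (shift (i + 1) j - shift i j')
  ε_homogeneous : ∀ j, ε (Pi.single j 1) ∈ 𝓜 (shift 0 j)
  ε_surjective : Function.Surjective ε
  exact_zero : Function.Exact (d 0) ε
  exact_succ : ∀ i, Function.Exact (d (i + 1)) (d i)

/-- A graded free resolution is minimal if `d (F_{i+1}) ⊆ 𝔪 F_i` for all `i`, where `𝔪` is the ideal
generated by all the variables. -/
def GradedFreeResolution.IsMinimal {K σ A M : Type*} [Field K] [AddCommGroup A] {w : σ → A}
    [AddCommGroup M] [Module (MvPolynomial σ K) M] {𝓜 : A → Set M}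
    (F : GradedFreeResolution (K := K) w 𝓜) : Prop :=
  ∀ i v j, F.d i v j ∈ Ideal.span (Set.range (X : σ → MvPolynomial σ K))

/-- The set of the shifts `a` of the summands `R(-a)` in homological degree `i` of the (unique up to
isomorphism) minimal graded free resolution. -/
def minimalShifts (K : Type*) {σ A M : Type*} [Field K] [AddCommGroup A] (w : σ → A)
    [AddCommGroup M] [Module (MvPolynomial σ K) M] (𝓜 : A → Set M) (i : ℕ) : Set A :=
  {a | ∃ F : GradedFreeResolution (K := K) w 𝓜, F.IsMinimal ∧ ∃ j, F.shift i j = a}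

/-! ## Ideals of the standard graded polynomial ring `S = K[x_1, …, x_n]` -/

section Ideals

variable {K : Type*} [Field K] {n : ℕ}

/-- The standard grading: the homogeneous elements of degree `a` of the ideal `I`. -/
def idealDegree (I : Ideal (MvPolynomial (Fin n) K)) (a : ℤ) : Set I :=
  {f | IsWeightedHomogeneous (fun _ : Fin n => (1 : ℤ)) (f : MvPolynomial (Fin n) K) a}

/-- The shifts in homological degree `i` of the minimal graded free `S`-resolution of `I`. -/
def idealShifts (I : Ideal (MvPolynomial (Fin n) K)) (i : ℕ) : Set ℤ :=
  minimalShifts K (fun _ : Fin n => (1 : ℤ)) (idealDegree I) i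

/-- The Castelnuovo–Mumford regularity `reg I = max {a - i}`, over all summands `S(-a)` in
homological degree `i` of the minimal graded free resolution of `I` (`-∞` for `I = 0`). -/
def reg (I : Ideal (MvPolynomial (Fin n) K)) : EReal :=
  ⨆ i : ℕ, ⨆ a ∈ idealShifts I i, (((a - i : ℤ) : ℝ) : EReal)

/-- `I` has a linear resolution: for some `c`, the module in homological degree `i` of its minimal
graded free resolution is a direct sum of copies of `S(-(c + i))`. -/
def HasLinearResolution (I : Ideal (MvPolynomial (Fin n) K)) : Prop :=
  ∃ c : ℤ, ∀ i : ℕ, ∀ a ∈ idealShifts I i, a = c + i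

/-- All the powers of `I` have a linear resolution. -/
def HasLinearPowers (I : Ideal (MvPolynomial (Fin n) K)) : Prop :=
  ∀ k : ℕ, 1 ≤ k → HasLinearResolution (I ^ k)

/-- The final degree `ω(I) = max {d : (I / 𝔪 I)_d ≠ 0}` (`-∞` for `I = 0`). -/
def finalDegree (I : Ideal (MvPolynomial (Fin n) K)) : EReal :=
  ⨆ d ∈ {d : ℕ | ∃ f ∈ I, f.IsHomogeneous d ∧
    f ∉ Ideal.span (Set.range (X : Fin n → MvPolynomial (Fin n) K)) * I}, (d : EReal)

/-- `I` is generated by monomials. -/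
def IsMonomialIdeal (I : Ideal (MvPolynomial (Fin n) K)) : Prop :=
  ∃ E : Set (Fin n →₀ ℕ), I = Ideal.span ((fun a => monomial a (1 : K)) '' E)

/-- `𝒢(I)`: the monomials of `I` that are minimal with respect to divisibility. -/
def minimalGenerators (I : Ideal (MvPolynomial (Fin n) K)) : Set (MvPolynomial (Fin n) K) :=
  {u | ∃ a : Fin n →₀ ℕ, u = monomial a 1 ∧ u ∈ I ∧
    ∀ b : Fin n →₀ ℕ, monomial b (1 : K) ∈ I → b ≤ a → b = a}

/-- `I` is a finite intersection of powers of monomial prime ideals. -/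
def IsIntersectionType (I : Ideal (MvPolynomial (Fin n) K)) : Prop :=
  ∃ (m : ℕ) (P : Fin m → Ideal (MvPolynomial (Fin n) K)) (e : Fin m → ℕ),
    (∀ i, (P i).IsPrime ∧ IsMonomialIdeal (P i) ∧ 1 ≤ e i) ∧ I = ⨅ i, P i ^ e i

/-- `I` is of intersection type and has no embedded associated primes. -/
def IsMinimalIntersectionType (I : Ideal (MvPolynomial (Fin n) K)) : Prop :=
  IsIntersectionType I ∧
    ∀ P ∈ associatedPrimes (MvPolynomial (Fin n) K) (MvPolynomial (Fin n) K ⧸ I),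
    ∀ Q ∈ associatedPrimes (MvPolynomial (Fin n) K) (MvPolynomial (Fin n) K ⧸ I),
      P ≤ Q → P = Q

end Ideals

/-! ## Symbolic powers and the symbolic Rees algebra -/

/-- The symbolic power `I^(k) = ⋂_{P ∈ Ass(I)} (I^k R_P ∩ R)`. -/
def symbolicPower {R : Type*} [CommRing R] [IsNoetherianRing R] (I : Ideal R) (k : ℕ) : Ideal R :=
  ⨅ P : associatedPrimes R (R ⧸ I),
    haveI : P.1.IsPrime := P.2.isPrime
    ((I ^ k).map (algebraMap R (Localization.AtPrime P.1))).comap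
      (algebraMap R (Localization.AtPrime P.1))

theorem symbolicPower_zero {R : Type*} [CommRing R] [IsNoetherianRing R] (I : Ideal R) :
    symbolicPower I 0 = ⊤ := by
  simp [symbolicPower, Ideal.one_eq_top, Ideal.map_top]

theorem mul_mem_symbolicPower {R : Type*} [CommRing R] [IsNoetherianRing R] {I : Ideal R}
    {k l : ℕ} {f g : R} (hf : f ∈ symbolicPower I k) (hg : g ∈ symbolicPower I l) :
    f * g ∈ symbolicPower I (k + l) := by
  simp only [symbolicPower, Ideal.mem_iInf, Ideal.mem_comap] at *
  intro P
  rw [map_mul, pow_add, Ideal.map_mul]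
  exact Ideal.mul_mem_mul (hf P) (hg P)

/-- The symbolic Rees algebra `⨁_k I^(k) t^k`, as a subalgebra of `R[t]`. -/
def symbolicRees {R : Type*} [CommRing R] [IsNoetherianRing R] (I : Ideal R) :
    Subalgebra R (Polynomial R) where
  carrier := {f | ∀ k, f.coeff k ∈ symbolicPower I k}
  mul_mem' := fun {f g} hf hg k => by
    rw [Polynomial.coeff_mul]
    refine Ideal.sum_mem _ fun p hp => ?_
    rw [← Finset.HasAntidiagonal.mem_antidiagonal.mp hp]
    exact mul_mem_symbolicPower (hf p.1) (hg p.2)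
  add_mem' := fun {f g} hf hg k => by
    rw [Polynomial.coeff_add]
    exact Ideal.add_mem _ (hf k) (hg k)
  algebraMap_mem' := fun r k => by
    rw [Polynomial.algebraMap_apply, Polynomial.coeff_C]
    split_ifs with h
    · subst h
      simp [symbolicPower_zero]
    · exact Ideal.zero_mem _

section Rees

variable {K : Type*} [Field K] {n : ℕ}

/-- The pairs `(a, q)` with `q > 0` such that `x^a t^q` is a minimal monomial generator of the
symbolic Rees algebra, that is, `x^a t^q` lies in it and is not a product of two monomials of it
both different from `1`. -/
def reesGenerators (I : Ideal (MvPolynomial (Fin n) K)) : Set ((Fin n →₀ ℕ) × ℕ) :=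
  {g | 0 < g.2 ∧ monomial g.1 1 ∈ symbolicPower I g.2 ∧
    ∀ g₁ g₂ : (Fin n →₀ ℕ) × ℕ, monomial g₁.1 1 ∈ symbolicPower I g₁.2 →
      monomial g₂.1 1 ∈ symbolicPower I g₂.2 → g₁ + g₂ = g → g₁ = 0 ∨ g₂ = 0}

/-- The element `x^a t^q` of the symbolic Rees algebra, for `(a, q) ∈ reesGenerators I`. -/
def reesGenerator (I : Ideal (MvPolynomial (Fin n) K)) (g : reesGenerators I) : symbolicRees I :=
  ⟨Polynomial.monomial g.1.2 (monomial g.1.1 1), fun k => by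
    rw [Polynomial.coeff_monomial]
    split_ifs with h
    · exact h ▸ g.2.2.1
    · exact Ideal.zero_mem _⟩

/-- The presentation `φ : T = K[x_1, …, x_n, y_1, …, y_m] → R_s(I)` with `x_i ↦ x_i` and
`y_j ↦ u_j t^{q_j}`, where the `y_j` are indexed by the generators `u_j t^{q_j}` with `q_j > 0`. -/
def reesPresentation (I : Ideal (MvPolynomial (Fin n) K)) :
    MvPolynomial (Fin n ⊕ reesGenerators I) K →ₐ[K] symbolicRees I :=
  aeval (Sum.elim (fun i => algebraMap (MvPolynomial (Fin n) K) (symbolicRees I) (X i))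
    (reesGenerator I))

/-- The bigrading of `T`: `bideg x_i = (1, 0)` and `bideg y_j = (deg u_j, q_j)`. -/
def reesWeight (I : Ideal (MvPolynomial (Fin n) K)) : Fin n ⊕ reesGenerators I → ℤ × ℤ :=
  Sum.elim (fun _ => (1, 0)) (fun g => ((g.1.1.degree : ℤ), (g.1.2 : ℤ)))

/-- The bigrading of `R_s(I)`: the elements of bidegree `(a, b)` are the `f t^b`, where `f ∈ I^(b)`
is homogeneous of degree `a`. -/
def reesDegree (I : Ideal (MvPolynomial (Fin n) K)) (c : ℤ × ℤ) : Set (symbolicRees I) :=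
  {f | ∀ k : ℕ,
    IsWeightedHomogeneous (fun _ : Fin n => (1 : ℤ)) ((f : Polynomial (MvPolynomial (Fin n) K)).coeff k) c.1 ∧
    ((k : ℤ) ≠ c.2 → (f : Polynomial (MvPolynomial (Fin n) K)).coeff k = 0)}

/-- The shifts in homological degree `i` of the minimal bigraded free `T`-resolution of `R_s(I)`,
which is a `T`-module through `φ`. -/
def reesShifts (I : Ideal (MvPolynomial (Fin n) K)) (i : ℕ) : Set (ℤ × ℤ) :=
  letI : Module (MvPolynomial (Fin n ⊕ reesGenerators I) K) (symbolicRees I) :=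
    Module.compHom _ (reesPresentation I).toRingHom
  minimalShifts K (reesWeight I) (reesDegree I) i

/-- The `x`-regularity `reg_x R_s(I) = max {a - i}`, over all summands `T(-a, -b)` in homological
degree `i` of the minimal bigraded free `T`-resolution of `R_s(I)`. -/
def regX (I : Ideal (MvPolynomial (Fin n) K)) : EReal :=
  ⨆ i : ℕ, ⨆ c ∈ reesShifts I i, (((c.1 - i : ℤ) : ℝ) : EReal)

/-- `d(I, k) = max ∑_s c_s deg(u_s)`, over all families `(c_s)` of natural numbers with
`∑_s c_s q_s ≤ k`, where `u_s t^{q_s}` are the minimal monomial generators of `R_s(I)` with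
`q_s > 0`. -/
def dMax (I : Ideal (MvPolynomial (Fin n) K)) (k : ℕ) : EReal :=
  ⨆ c ∈ {c : reesGenerators I →₀ ℕ | c.sum (fun g m => m * g.1.2) ≤ k},
    ((c.sum (fun g m => m * g.1.1.degree) : ℕ) : EReal)

end Rees

end SymbolicReg

end

noncomputable section

namespace SymbolicReg

open MvPolynomial

/-! ## Comparison of resolutions -/

/-! Each associated prime `P` of `I` is one of the monomial primes of the intersection. As there are
no embedded primes, `I` agrees with a power `P ^ e P` locally at `P`. Powers of monomial primes are
primary and are described by the weight counting the variables in `P`. So `x^a` lies in `I^(k)`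
exactly when this weight of `a` is at least `k * e P` for every `P`
(`exists_mem_symbolicPower_iff`). These inequalities scale with `k`, so tight ones stay tight:
powers of minimal generators are minimal (`pow_mem_minimalGenerators`). Hence `ω(I) k ≤ ω(I^(k))`,
and `ω ≤ reg` because generator degrees are shifts in homological degree 0. With linear powers, a
nonzero `I` is generated in the single degree `ω(I)`, so `reg I^k = ω(I) k`
(`HasLinearPowers.reg_pow`) and the lower bound becomes a comparison with `I^k`.

For the upper bound (`reg_symbolicPower_le_dMax`), the minimal bigraded `T`-resolution `G` of
`R_s(I)` is read over `S`. There `I^(k)` is a retract of `R_s(I)`, so a lift of the inclusion from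
its minimal resolution to `G` is injective modulo `𝔪` (`mem_smul_top_of_lift_mem`). A basis element
of degree `a` in homological degree `i` thus yields an element of `G i` of bidegree `(a, k)` outside
`𝔪 G i`. Some term of it contains no `x`-variable. The `y`-part of that term has degree at most
`d(I, k)`, and the shift at most `i` since `reg_x = 0`. So `a - i ≤ d(I, k)`. -/

/-- Dependent choice behind every degreewise construction below: homotopies, chain maps and
resolutions. The invariant `P` carries what makes the next step possible. -/
theorem exists_dependent_seq {α : ℕ → Type*} (B : α 0 → Prop) (P : ∀ i, α i → Prop)
    (R : ∀ i, α i → α (i + 1) → Prop) (h0 : ∃ a, B a ∧ P 0 a)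
    (hs : ∀ i a, P i a → ∃ b, P (i + 1) b ∧ R i a b) :
    ∃ f : ∀ i, α i, B (f 0) ∧ (∀ i, P i (f i)) ∧ ∀ i, R i (f i) (f (i + 1)) := by
  obtain ⟨a, ha, ha'⟩ := h0
  choose g hg hg' using hs
  let f : ∀ i, {a : α i // P i a} := fun i =>
    Nat.rec (motive := fun i => {a : α i // P i a}) ⟨a, ha'⟩
      (fun i x => ⟨g i x.1 x.2, hg i x.1 x.2⟩) i
  exact ⟨fun i => (f i).1, ha, fun i => (f i).2, fun i => hg' i (f i).1 (f i).2⟩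

/-- A linear map from a projective module lifts along `d` as soon as it lands in its range. -/
theorem exists_lift_of_mem_range {S P M N : Type*} [CommRing S] [AddCommGroup P] [Module S P]
    [Module.Projective S P] [AddCommGroup M] [Module S M] [AddCommGroup N] [Module S N]
    (d : M →ₗ[S] N) (g : P →ₗ[S] N) (h : ∀ x, g x ∈ LinearMap.range d) :
    ∃ l : P →ₗ[S] M, ∀ x, d (l x) = g x := by
  obtain ⟨l, hl⟩ := Module.projective_lifting_property d.rangeRestrict (g.codRestrict _ h)
    d.surjective_rangeRestrict
  refine ⟨l, fun x => ?_⟩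
  have := congrArg Subtype.val (LinearMap.congr_fun hl x)
  simpa using this

section Comparison

variable {S : Type*} [CommRing S] {F : ℕ → Type*} [∀ i, AddCommGroup (F i)] [∀ i, Module S (F i)]
  {M : Type*} [AddCommGroup M] [Module S M]
  (dF : ∀ i, F (i + 1) →ₗ[S] F i) (εF : F 0 →ₗ[S] M)

/-- An endomorphism of a projective resolution that lifts the identity is the identity modulo `𝔪`
if the resolution is minimal. -/
theorem sub_self_mem_of_lifts_id [∀ i, Module.Projective S (F i)]
    (hF0 : Function.Exact (dF 0) εF) (hF : ∀ i, Function.Exact (dF (i + 1)) (dF i))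
    {𝔪 : Ideal S} (hmin : ∀ i x, dF i x ∈ 𝔪 • (⊤ : Submodule S (F i)))
    (χ : ∀ i, F i →ₗ[S] F i) (hχ0 : ∀ x, εF (χ 0 x) = εF x)
    (hχ : ∀ i x, dF i (χ (i + 1) x) = χ i (dF i x)) (i : ℕ) (x : F i) :
    χ i x - x ∈ 𝔪 • (⊤ : Submodule S (F i)) := by
  -- `h` is a homotopy `χ - 1 = d h + h d`; both summands land in `𝔪 F` because `d` does. The
  -- invariant says that `χ - 1 - h d` is killed by `d`, hence lifts along the next differential.
  obtain ⟨h, h0, -, hh⟩ := exists_dependent_seq (α := fun i => F i →ₗ[S] F (i + 1))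
    (fun h => ∀ x, dF 0 (h x) = χ 0 x - x)
    (fun i h => ∀ x, dF i (h (dF i x)) = χ i (dF i x) - dF i x)
    (fun i h h' => ∀ x, dF (i + 1) (h' x) = χ (i + 1) x - x - h (dF i x))
    (by
      obtain ⟨h, hh⟩ := exists_lift_of_mem_range (dF 0) (χ 0 - LinearMap.id) fun x => by
        rw [LinearMap.mem_range, ← Set.mem_range, ← hF0]
        simp [hχ0]
      exact ⟨h, by simpa using hh, fun x => by simpa using hh (dF 0 x)⟩)
    (by
      intro i h hP
      obtain ⟨h', hh'⟩ := exists_lift_of_mem_range (dF (i + 1))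
        (χ (i + 1) - LinearMap.id - h ∘ₗ dF i) fun x => by
          rw [LinearMap.mem_range, ← Set.mem_range, ← hF]
          simp [hχ, hP]
      have hh'' : ∀ x, dF (i + 1) (h' x) = χ (i + 1) x - x - h (dF i x) := by simpa using hh'
      refine ⟨h', fun x => ?_, hh''⟩
      rw [hh'', (hF i).apply_apply_eq_zero]
      simp)
  cases i with
  | zero => exact h0 x ▸ hmin 0 _
  | succ i =>
    have : χ (i + 1) x - x = dF (i + 1) (h (i + 1) x) + h i (dF i x) := by rw [hh]; abel
    rw [this]
    refine add_mem (hmin _ _) ?_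
    have := Submodule.mem_map_of_mem (f := h i) (hmin i x)
    rw [Submodule.map_smul''] at this
    exact Submodule.smul_mono le_rfl le_top this

variable {G : ℕ → Type*} [∀ i, AddCommGroup (G i)] [∀ i, Module S (G i)]
  {N : Type*} [AddCommGroup N] [Module S N]
  (dG : ∀ i, G (i + 1) →ₗ[S] G i) (εG : G 0 →ₗ[S] N)

theorem exists_lift_chain_map [∀ i, Module.Projective S (G i)]
    (hF0 : Function.Exact (dF 0) εF) (hF : ∀ i, Function.Exact (dF (i + 1)) (dF i))
    (hεF : Function.Surjective εF)
    (hG0 : Function.Exact (dG 0) εG) (hG : ∀ i, Function.Exact (dG (i + 1)) (dG i))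
    (π : N →ₗ[S] M) :
    ∃ ψ : ∀ i, G i →ₗ[S] F i, (∀ x, εF (ψ 0 x) = π (εG x)) ∧
      ∀ i x, dF i (ψ (i + 1) x) = ψ i (dG i x) := by
  obtain ⟨ψ, h0, -, hψ⟩ := exists_dependent_seq (α := fun i => G i →ₗ[S] F i)
    (fun h => ∀ x, εF (h x) = π (εG x))
    (fun i h => ∀ x, h (dG i x) ∈ Set.range (dF i))
    (fun i h h' => ∀ x, dF i (h' x) = h (dG i x))
    (by
      obtain ⟨h, hh⟩ := exists_lift_of_mem_range εF (π ∘ₗ εG) fun x => hεF _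
      refine ⟨h, hh, fun x => ?_⟩
      rw [← hF0, hh]
      simp [hG0.apply_apply_eq_zero])
    (by
      intro i h hP
      obtain ⟨h', hh'⟩ := exists_lift_of_mem_range (dF i) (h ∘ₗ dG i) hP
      refine ⟨h', fun x => ?_, hh'⟩
      rw [← hF, hh']
      simp [(hG i).apply_apply_eq_zero])
  exact ⟨ψ, h0, hψ⟩

/-- If `M` is a retract of `N`, then the composite of a minimal projective resolution of `M` with a
lift to a projective resolution of `N` is injective modulo `𝔪`. -/
theorem mem_smul_top_of_lift_mem [∀ i, Module.Projective S (F i)] [∀ i, Module.Projective S (G i)]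
    (hF0 : Function.Exact (dF 0) εF) (hF : ∀ i, Function.Exact (dF (i + 1)) (dF i))
    (hεF : Function.Surjective εF)
    (hG0 : Function.Exact (dG 0) εG) (hG : ∀ i, Function.Exact (dG (i + 1)) (dG i))
    {𝔪 : Ideal S} (hmin : ∀ i x, dF i x ∈ 𝔪 • (⊤ : Submodule S (F i)))
    (ι : M →ₗ[S] N) (π : N →ₗ[S] M) (hπ : ∀ x, π (ι x) = x)
    (φ : ∀ i, F i →ₗ[S] G i) (hφ0 : ∀ x, εG (φ 0 x) = ι (εF x))
    (hφ : ∀ i x, dG i (φ (i + 1) x) = φ i (dF i x)) (i : ℕ) (x : F i)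
    (hx : φ i x ∈ 𝔪 • (⊤ : Submodule S (G i))) : x ∈ 𝔪 • (⊤ : Submodule S (F i)) := by
  -- Lifting `π` to `ψ` makes `ψ ∘ φ` a lift of `π ∘ ι = id`, hence the identity modulo `𝔪`.
  obtain ⟨ψ, hψ0, hψ⟩ := exists_lift_chain_map dF εF dG εG hF0 hF hεF hG0 hG π
  have h1 := sub_self_mem_of_lifts_id dF εF hF0 hF hmin (fun i => ψ i ∘ₗ φ i)
    (fun x => by simp [hψ0, hφ0, hπ]) (fun i x => by simp [hψ, hφ]) i x
  have h2 : ψ i (φ i x) ∈ 𝔪 • (⊤ : Submodule S (F i)) := by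
    have := Submodule.mem_map_of_mem (f := ψ i) hx
    rw [Submodule.map_smul''] at this
    exact Submodule.smul_mono le_rfl le_top this
  simpa using sub_mem h2 h1

end Comparison

/-! ## Graded modules -/

section Graded

variable {K σ A M : Type*} [Field K] [AddCommGroup A] {w : σ → A}
  [AddCommGroup M] [Module (MvPolynomial σ K) M]

/-- The sets `𝓜 a` are compatible with multiplication by homogeneous polynomials, and the `p a` are
projections onto them that annihilate the other ones. -/
structure GradingProj (w : σ → A) (𝓜 : A → Set M) (p : A → M →+ M) : Prop where
  smul_mem : ∀ {a b : A} {f : MvPolynomial σ K} {m : M}, IsWeightedHomogeneous w f a →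
    m ∈ 𝓜 b → f • m ∈ 𝓜 (a + b)
  proj_of_mem : ∀ {a : A} {m : M}, m ∈ 𝓜 a → p a m = m
  proj_of_ne : ∀ {a b : A} {m : M}, m ∈ 𝓜 a → b ≠ a → p b m = 0
  proj_mem : ∀ a m, p a m ∈ 𝓜 a

variable {𝓜 : A → Set M} {p : A → M →+ M}

theorem GradingProj.proj_smul (h : GradingProj (K := K) w 𝓜 p) {b : A} {m : M} (hm : m ∈ 𝓜 b)
    (a : A) (f : MvPolynomial σ K) :
    p a (f • m) = weightedHomogeneousComponent w (a - b) f • m := by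
  classical
  induction f using MvPolynomial.induction_on' with
  | add f g hf hg => simp only [add_smul, map_add, hf, hg]
  | monomial d c =>
    have hd := isWeightedHomogeneous_monomial w d c rfl
    have hmem := h.smul_mem hd hm
    by_cases ha : a = Finsupp.weight w d + b
    · subst ha
      rw [h.proj_of_mem hmem, add_sub_cancel_right, hd.weightedHomogeneousComponent_same]
    · rw [h.proj_of_ne hmem ha, hd.weightedHomogeneousComponent_ne, zero_smul]
      rintro h'
      exact ha (sub_eq_iff_eq_add.1 h')

/-- `𝓜 a` is only a set; it is closed under sums because it is the fixed set of the additive map `p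
a`. -/
theorem GradingProj.sum_mem (h : GradingProj (K := K) w 𝓜 p) {a : A} {ι : Type*} (s : Finset ι)
    (x : ι → M) (hx : ∀ i ∈ s, x i ∈ 𝓜 a) : ∑ i ∈ s, x i ∈ 𝓜 a := by
  have : p a (∑ i ∈ s, x i) = ∑ i ∈ s, x i := by
    rw [map_sum]
    exact Finset.sum_congr rfl fun i hi => h.proj_of_mem (hx i hi)
  exact this ▸ h.proj_mem a _

variable {ι : Type*}

/-- The homogeneous elements of degree `a` of `⨁_j R(-s j)`. -/
def freeDegree (K : Type*) [Field K] (w : σ → A) (s : ι → A) (a : A) :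
    Set (ι → MvPolynomial σ K) :=
  {f | ∀ j, IsWeightedHomogeneous w (f j) (a - s j)}

/-- The homogeneous component of degree `a` in `⨁_j R(-s j)`. -/
def freeProj (K : Type*) [Field K] (w : σ → A) (s : ι → A) (a : A) :
    (ι → MvPolynomial σ K) →+ (ι → MvPolynomial σ K) where
  toFun f j := weightedHomogeneousComponent w (a - s j) (f j)
  map_zero' := by ext; simp
  map_add' f g := by ext; simp

theorem weightedHomogeneousComponent_mul_right {b : A} {g : MvPolynomial σ K}
    (hg : IsWeightedHomogeneous w g b) (a : A) (f : MvPolynomial σ K) :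
    weightedHomogeneousComponent w a (f * g) =
      weightedHomogeneousComponent w (a - b) f * g := by
  classical
  induction f using MvPolynomial.induction_on' with
  | add f f' hf hf' => simp only [add_mul, map_add, hf, hf']
  | monomial d c =>
    have hd := isWeightedHomogeneous_monomial w d c rfl
    by_cases ha : a = Finsupp.weight w d + b
    · subst ha
      rw [(hd.mul hg).weightedHomogeneousComponent_same, add_sub_cancel_right,
        hd.weightedHomogeneousComponent_same]
    · rw [(hd.mul hg).weightedHomogeneousComponent_ne _ ha,
        hd.weightedHomogeneousComponent_ne, zero_mul]
      rintro h'
      exact ha (sub_eq_iff_eq_add.1 h')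

theorem gradingProj_free (s : ι → A) :
    GradingProj (K := K) w (freeDegree K w s) (freeProj K w s) where
  smul_mem {a b f m} hf hm j := by
    simpa [add_sub_assoc] using hf.mul (hm j)
  proj_of_mem {a m} hm := by
    classical
    ext1 j
    exact (hm j).weightedHomogeneousComponent_same
  proj_of_ne {a b m} hm hab := by
    classical
    ext1 j
    exact (hm j).weightedHomogeneousComponent_ne _ (by simpa using hab)
  proj_mem a m j := weightedHomogeneousComponent_isWeightedHomogeneous _ _

theorem apply_eq_sum_smul_single {R : Type*} [CommRing R] {M : Type*} [AddCommGroup M] [Module R M]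
    [Fintype ι] [DecidableEq ι] (l : (ι → R) →ₗ[R] M) (f : ι → R) :
    l f = ∑ j, f j • l (Pi.single j 1) := by
  conv_lhs => rw [← Finset.univ_sum_single f, map_sum]
  refine Finset.sum_congr rfl fun j _ => ?_
  rw [← map_smul, ← Pi.single_smul, smul_eq_mul, mul_one]

variable [Fintype ι] [DecidableEq ι]

theorem GradingProj.proj_apply (h : GradingProj (K := K) w 𝓜 p) {s : ι → A}
    {l : (ι → MvPolynomial σ K) →ₗ[MvPolynomial σ K] M} (hl : ∀ j, l (Pi.single j 1) ∈ 𝓜 (s j))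
    (a : A) (f : ι → MvPolynomial σ K) : p a (l f) = l (freeProj K w s a f) := by
  rw [apply_eq_sum_smul_single l f, apply_eq_sum_smul_single l (freeProj K w s a f), map_sum]
  exact Finset.sum_congr rfl fun j _ => h.proj_smul (hl j) a _

/-- Homogeneous elements in the range of a homogeneous map lift to homogeneous elements. -/
theorem GradingProj.exists_homogeneous_preimage (h : GradingProj (K := K) w 𝓜 p) {s : ι → A}
    {l : (ι → MvPolynomial σ K) →ₗ[MvPolynomial σ K] M} (hl : ∀ j, l (Pi.single j 1) ∈ 𝓜 (s j))
    {a : A} {m : M} (hm : m ∈ 𝓜 a) (hm' : m ∈ Set.range l) :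
    ∃ f ∈ freeDegree K w s a, l f = m := by
  obtain ⟨f, rfl⟩ := hm'
  exact ⟨freeProj K w s a f, (gradingProj_free s).proj_mem _ _, by
    rw [← h.proj_apply hl, h.proj_of_mem hm]⟩

theorem mem_smul_top_pi_iff {R : Type*} [CommRing R] (J : Ideal R) (f : ι → R) :
    f ∈ J • (⊤ : Submodule R (ι → R)) ↔ ∀ j, f j ∈ J := by
  constructor
  · intro hf j
    have := Submodule.mem_map_of_mem (f := LinearMap.proj (R := R) (φ := fun _ : ι => R) j) hf
    rw [Submodule.map_smul''] at this
    have h2 := Submodule.smul_mono le_rfl (le_top : _ ≤ (⊤ : Submodule R R)) this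
    simpa using h2
  · intro hf
    rw [← Finset.univ_sum_single f]
    refine Submodule.sum_mem _ fun j _ => ?_
    have : Pi.single j (f j) = f j • (Pi.single j 1 : ι → R) := by
      rw [← Pi.single_smul, smul_eq_mul, mul_one]
    rw [this]
    exact Submodule.smul_mem_smul (hf j) trivial

end Graded

/-- Let `F` be a minimal graded free resolution of a retract `M` of `N`, and `G` an exact complex of
projective modules over `N` with enough homogeneous elements. Then every basis element of `F i` has
the degree of some element of `G i` that is nonzero modulo `𝔪`. -/
theorem GradedFreeResolution.IsMinimal.exists_notMem {K σ A M : Type*} [Field K] [AddCommGroup A]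
    {w : σ → A} [AddCommGroup M] [Module (MvPolynomial σ K) M] {𝓜 : A → Set M}
    {F : GradedFreeResolution (K := K) w 𝓜} (hF : F.IsMinimal)
    {G : ℕ → Type*} [∀ i, AddCommGroup (G i)] [∀ i, Module (MvPolynomial σ K) (G i)]
    [∀ i, Module.Projective (MvPolynomial σ K) (G i)]
    {N : Type*} [AddCommGroup N] [Module (MvPolynomial σ K) N]
    (dG : ∀ i, G (i + 1) →ₗ[MvPolynomial σ K] G i) (εG : G 0 →ₗ[MvPolynomial σ K] N)
    (hG0 : Function.Exact (dG 0) εG) (hG : ∀ i, Function.Exact (dG (i + 1)) (dG i))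
    (𝓖 : ∀ i, A → Set (G i))
    (hsum : ∀ i a (r : ℕ) (y : Fin r → G i), (∀ j, y j ∈ 𝓖 i a) → ∑ j, y j ∈ 𝓖 i a)
    (hsmul : ∀ i a b (f : MvPolynomial σ K), IsWeightedHomogeneous w f a → ∀ y ∈ 𝓖 i b, f • y ∈ 𝓖 i (a + b))
    (ι : M →ₗ[MvPolynomial σ K] N) (π : N →ₗ[MvPolynomial σ K] M) (hπ : ∀ x, π (ι x) = x)
    (h0 : ∀ a, ∀ m ∈ 𝓜 a, ∃ z ∈ 𝓖 0 a, εG z = ι m)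
    (hd : ∀ i a, ∀ y ∈ 𝓖 i a, y ∈ Set.range (dG i) → ∃ z ∈ 𝓖 (i + 1) a, dG i z = y)
    (i : ℕ) (j : Fin (F.rank i)) :
    ∃ y ∈ 𝓖 i (F.shift i j), y ∉ Ideal.span (Set.range (X : σ → MvPolynomial σ K)) •
      (⊤ : Submodule (MvPolynomial σ K) (G i)) := by
  have lift : ∀ {r i : ℕ} (y : Fin r → G i),
      ∃ φ : (Fin r → MvPolynomial σ K) →ₗ[MvPolynomial σ K] G i,
        ∀ j, φ (Pi.single j 1) = y j := by
    intro r i y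
    refine ⟨(Pi.basisFun (MvPolynomial σ K) (Fin r)).constr (MvPolynomial σ K) y, fun j => ?_⟩
    rw [← Pi.basisFun_apply, Module.Basis.constr_basis]
  -- A chain map lifting `ι` and preserving degrees: the images of basis elements are chosen
  -- homogeneous through `h0` and `hd`.
  obtain ⟨φ, hφ0, hP, hφ⟩ := exists_dependent_seq
    (α := fun i => (Fin (F.rank i) → MvPolynomial σ K) →ₗ[MvPolynomial σ K] G i)
    (fun φ => ∀ x, εG (φ x) = ι (F.ε x))
    (fun i φ => (∀ j, φ (Pi.single j 1) ∈ 𝓖 i (F.shift i j)) ∧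
      ∀ x, φ (F.d i x) ∈ Set.range (dG i))
    (fun i φ φ' => ∀ x, dG i (φ' x) = φ (F.d i x))
    (by
      choose y hy hy' using fun j => h0 _ _ (F.ε_homogeneous j)
      obtain ⟨φ, hφ⟩ := lift y
      have hx : ∀ x, εG (φ x) = ι (F.ε x) := by
        intro x
        rw [apply_eq_sum_smul_single φ x, apply_eq_sum_smul_single F.ε x]
        simp [hφ, hy']
      refine ⟨φ, hx, fun j => (hφ j).symm ▸ hy j, fun x => ?_⟩
      rw [← hG0, hx, F.exact_zero.apply_apply_eq_zero, map_zero])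
    (by
      rintro i φ ⟨hφ, hφ'⟩
      have hde : ∀ j, φ (F.d i (Pi.single j 1)) ∈ 𝓖 i (F.shift (i + 1) j) := by
        intro j
        rw [apply_eq_sum_smul_single φ]
        refine hsum _ _ _ _ fun l => ?_
        simpa using hsmul i _ _ _ (F.d_homogeneous i j l) _ (hφ l)
      choose y hy hy' using fun j => hd i _ _ (hde j) (hφ' _)
      obtain ⟨φ', hφ''⟩ := lift y
      have hx : ∀ x, dG i (φ' x) = φ (F.d i x) := by
        intro x
        rw [apply_eq_sum_smul_single φ' x, apply_eq_sum_smul_single (F.d i) x]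
        simp [hφ'', hy']
      refine ⟨φ', ⟨fun j => (hφ'' j).symm ▸ hy j, fun x => ?_⟩, hx⟩
      rw [← hG, hx, (F.exact_succ i).apply_apply_eq_zero, map_zero])
  refine ⟨φ i (Pi.single j 1), (hP i).1 j, fun hmem => ?_⟩
  have := mem_smul_top_of_lift_mem F.d F.ε dG εG F.exact_zero F.exact_succ F.ε_surjective hG0 hG
    (fun i x => (mem_smul_top_pi_iff _ _).2 (hF i x)) ι π hπ φ hφ0 hφ i _ hmem
  rw [mem_smul_top_pi_iff] at this
  have h1 := this j
  rw [Pi.single_eq_same] at h1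
  have hle : Ideal.span (Set.range (X : σ → MvPolynomial σ K)) ≤
      RingHom.ker (constantCoeff (R := K) (σ := σ)) := by
    rw [Ideal.span_le]
    rintro _ ⟨i, rfl⟩
    simp
  simpa using hle h1

/-! ## Existence of minimal graded free resolutions -/

section Existence

variable {K σ A M : Type*} [Field K] [AddCommGroup A] {w : σ → A}
  [AddCommGroup M] [Module (MvPolynomial σ K) M] {𝓜 : A → Set M} {p : A → M →+ M}

theorem mem_span_range_X_iff (f : MvPolynomial σ K) :
    f ∈ Ideal.span (Set.range (X : σ → MvPolynomial σ K)) ↔ coeff 0 f = 0 := by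
  rw [← Set.image_univ, mem_ideal_span_X_image]
  constructor
  · intro h
    by_contra h0
    simpa using h 0 (mem_support_iff.2 h0)
  · intro h m hm
    have : m ≠ 0 := by
      rintro rfl
      exact mem_support_iff.1 hm h
    obtain ⟨i, hi⟩ := Finsupp.ne_iff.1 this
    exact ⟨i, trivial, by simpa using hi⟩

theorem mem_span_range_freeProj {ι : Type*} [Fintype ι] (s : ι → A)
    (f : ι → MvPolynomial σ K) :
    f ∈ Submodule.span (MvPolynomial σ K) (Set.range fun a => freeProj K w s a f) := by
  classical
  let T : Finset A := Finset.univ.biUnion fun j =>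
    (f j).support.image fun d : σ →₀ ℕ => Finsupp.weight w d + s j
  have hf : f = ∑ a ∈ T, freeProj K w s a f := by
    ext j d
    rw [Finset.sum_apply, coeff_sum]
    simp only [freeProj, AddMonoidHom.coe_mk, ZeroHom.coe_mk, coeff_weightedHomogeneousComponent,
      eq_sub_iff_add_eq]
    rw [Finset.sum_ite_eq]
    split_ifs with h
    · rfl
    · by_contra hne
      refine h (Finset.mem_biUnion.2 ⟨j, Finset.mem_univ _, Finset.mem_image.2 ⟨d, ?_, rfl⟩⟩)
      exact mem_support_iff.2 hne
  have hs : ∑ a ∈ T, freeProj K w s a f ∈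
      Submodule.span (MvPolynomial σ K) (Set.range fun a => freeProj K w s a f) :=
    Submodule.sum_mem _ fun a _ => Submodule.subset_span (Set.mem_range_self a)
  rwa [← hf] at hs

/-- With only constants in degree zero, a degree-zero coefficient in a relation among generators is
zero or a unit. This is the graded Nakayama argument used next. -/
theorem weightedHomogeneousComponent_zero_eq_C (hw : ∀ d : σ →₀ ℕ, Finsupp.weight w d = 0 → d = 0)
    (f : MvPolynomial σ K) : weightedHomogeneousComponent w 0 f = C (coeff 0 f) := by
  classical
  ext d
  rw [coeff_weightedHomogeneousComponent, coeff_C]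
  by_cases hd : d = 0
  · subst hd
    simp
  · rw [if_neg fun h => hd (hw d h), if_neg (Ne.symm hd)]

/-- A submodule generated by homogeneous elements is the image of a graded free module under a
homogeneous map whose kernel is contained in `𝔪 F`. -/
theorem GradingProj.exists_minimal_cover (h : GradingProj (K := K) w 𝓜 p)
    (hw : ∀ d : σ →₀ ℕ, Finsupp.weight w d = 0 → d = 0) (N : Submodule (MvPolynomial σ K) M) (hN : N.FG)
    (hspan : N ≤ Submodule.span _ {m | m ∈ N ∧ ∃ a, m ∈ 𝓜 a}) :
    ∃ (r : ℕ) (s : Fin r → A) (l : (Fin r → MvPolynomial σ K) →ₗ[MvPolynomial σ K] M),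
      (∀ j, l (Pi.single j 1) ∈ 𝓜 (s j)) ∧ LinearMap.range l = N ∧
      ∀ f, l f = 0 → ∀ j, f j ∈ Ideal.span (Set.range (X : σ → MvPolynomial σ K)) := by
  classical
  have hN' : N = Submodule.span (MvPolynomial σ K) {m | m ∈ N ∧ ∃ a, m ∈ 𝓜 a} :=
    le_antisymm hspan (Submodule.span_le.2 fun m hm => hm.1)
  have hex : ∃ r : ℕ, ∃ (m : Fin r → M) (s : Fin r → A), (∀ j, m j ∈ 𝓜 (s j)) ∧
      Submodule.span (MvPolynomial σ K) (Set.range m) = N := by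
    obtain ⟨t, ht, ht'⟩ := Submodule.fg_span_iff_fg_span_finset_subset _ |>.1 (hN' ▸ hN)
    choose s hs using fun x : t => (ht x.2).2
    refine ⟨t.card, fun j => (t.equivFin.symm j : M), fun j => s (t.equivFin.symm j),
      fun j => hs _, ?_⟩
    rw [hN', ht']
    congr 1
    ext x
    constructor
    · rintro ⟨j, rfl⟩
      exact (t.equivFin.symm j).2
    · intro hx
      exact ⟨t.equivFin ⟨x, hx⟩, by simp⟩
  -- A homogeneous generating family of least length: a relation with a nonzero constant term in
  -- some coefficient would make that generator redundant.
  obtain ⟨m, s, hm, hspanm⟩ := Nat.find_spec hex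
  have hmin := fun r => Nat.find_min hex (m := r)
  generalize Nat.find hex = r at m s hm hspanm hmin
  let l := Fintype.linearCombination (MvPolynomial σ K) m
  have hl : ∀ j, l (Pi.single j 1) = m j := fun j => by
    simp [l, Fintype.linearCombination_apply_single]
  have hl' : ∀ j, l (Pi.single j 1) ∈ 𝓜 (s j) := fun j => (hl j).symm ▸ hm j
  refine ⟨r, s, l, hl', ?_, fun f hf j => ?_⟩
  · rw [Fintype.range_linearCombination, hspanm]
  rw [mem_span_range_X_iff]
  by_contra hc
  obtain ⟨r, rfl⟩ : ∃ r', r = r' + 1 := ⟨r - 1, by have := j.2; omega⟩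
  refine hmin r (Nat.lt_succ_self r) ⟨m ∘ j.succAbove, s ∘ j.succAbove, fun i => hm _, ?_⟩
  rw [← hspanm]
  refine le_antisymm (Submodule.span_mono (Set.range_comp_subset_range _ _)) ?_
  rw [Submodule.span_le]
  have hother : ∀ i, i ≠ j →
      m i ∈ Submodule.span (MvPolynomial σ K) (Set.range (m ∘ j.succAbove)) := by
    intro i hi
    obtain ⟨i, rfl⟩ := Fin.exists_succAbove_eq hi
    exact Submodule.subset_span ⟨i, rfl⟩
  -- In the component of degree `s j` the `j`-th coefficient is a nonzero scalar, so `m j` can be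
  -- solved for.
  have hker : l (freeProj K w s (s j) f) = 0 := by
    rw [← h.proj_apply hl', hf, map_zero]
  rw [apply_eq_sum_smul_single l, ← Finset.add_sum_erase _ _ (Finset.mem_univ j)] at hker
  simp only [hl] at hker
  have hj : freeProj K w s (s j) f j = C (coeff 0 (f j)) := by
    simp [freeProj, weightedHomogeneousComponent_zero_eq_C hw]
  have hmj : m j = (C (coeff 0 (f j))⁻¹ : MvPolynomial σ K) •
      (C (coeff 0 (f j)) : MvPolynomial σ K) • m j := by
    rw [← mul_smul, ← C_mul, inv_mul_cancel₀ hc, C_1, one_smul]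
  rintro _ ⟨i, rfl⟩
  by_cases hi : i = j
  · subst hi
    rw [SetLike.mem_coe, hmj, ← hj, eq_neg_of_add_eq_zero_left hker]
    refine Submodule.smul_mem _ _ (Submodule.neg_mem _ (Submodule.sum_mem _ fun l hl => ?_))
    exact Submodule.smul_mem _ _ (hother l (Finset.ne_of_mem_erase hl))
  · exact hother i hi

/-- `minimalShifts` is empty when no minimal resolution exists, so lower bounds on `reg` and
consequences of a linear resolution require one. -/
theorem GradingProj.exists_isMinimal [Finite σ] [Module.Finite (MvPolynomial σ K) M]
    (h : GradingProj (K := K) w 𝓜 p) (hw : ∀ d : σ →₀ ℕ, Finsupp.weight w d = 0 → d = 0)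
    (hspan : ∀ m, m ∈ Submodule.span (MvPolynomial σ K) (Set.range fun a => p a m)) :
    ∃ F : GradedFreeResolution (K := K) w 𝓜, F.IsMinimal := by
  classical
  -- A stage records rank, shifts and the kernel of the outgoing map. This kernel is graded, lies in
  -- `𝔪 F`, and is what the next stage covers.
  obtain ⟨f, ⟨ε, hε, hεr, hεk⟩, hP, hR⟩ := exists_dependent_seq
    (α := fun _ => Σ r : ℕ, (Fin r → A) × Submodule (MvPolynomial σ K) (Fin r → MvPolynomial σ K))
    (fun Y => ∃ ε : (Fin Y.1 → MvPolynomial σ K) →ₗ[MvPolynomial σ K] M,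
      (∀ j, ε (Pi.single j 1) ∈ 𝓜 (Y.2.1 j)) ∧ LinearMap.range ε = ⊤ ∧ LinearMap.ker ε = Y.2.2)
    (fun _ Y => (∀ a, ∀ x ∈ Y.2.2, freeProj K w Y.2.1 a x ∈ Y.2.2) ∧
      ∀ x ∈ Y.2.2, ∀ j, x j ∈ Ideal.span (Set.range (X : σ → MvPolynomial σ K)))
    (fun _ Y Z => ∃ d : (Fin Z.1 → MvPolynomial σ K) →ₗ[MvPolynomial σ K]
        (Fin Y.1 → MvPolynomial σ K), (∀ j, d (Pi.single j 1) ∈ freeDegree K w Y.2.1 (Z.2.1 j)) ∧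
      LinearMap.range d = Y.2.2 ∧ LinearMap.ker d = Z.2.2)
    (by
      obtain ⟨r, s, l, hl, hr, hk⟩ := h.exists_minimal_cover hw ⊤ Module.Finite.fg_top
        (fun m _ => Submodule.span_mono
          (by rintro _ ⟨a, rfl⟩; exact ⟨trivial, a, h.proj_mem _ _⟩) (hspan m))
      refine ⟨⟨r, s, LinearMap.ker l⟩, ⟨l, hl, hr, rfl⟩, fun a x hx => ?_, hk⟩
      rw [LinearMap.mem_ker] at hx ⊢
      rw [← h.proj_apply hl, hx, map_zero])
    (by
      rintro - ⟨r, s, N⟩ ⟨hN, -⟩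
      have hs := gradingProj_free (K := K) (w := w) s
      obtain ⟨r', s', l, hl, hr, hk⟩ := hs.exists_minimal_cover hw N (IsNoetherian.noetherian N)
        (fun m hm => Submodule.span_mono
          (by rintro _ ⟨a, rfl⟩; exact ⟨hN a m hm, a, hs.proj_mem _ _⟩)
          (mem_span_range_freeProj (w := w) s m))
      refine ⟨⟨r', s', LinearMap.ker l⟩, ⟨fun a x hx => ?_, hk⟩, l, hl, hr, rfl⟩
      rw [LinearMap.mem_ker] at hx ⊢
      rw [← hs.proj_apply hl, hx, map_zero])
  choose d hd hdr hdk using hR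
  refine ⟨{ rank := fun i => (f i).1
            shift := fun i => (f i).2.1
            d := d
            ε := ε
            d_homogeneous := fun i j j' => hd i j j'
            ε_homogeneous := hε
            ε_surjective := LinearMap.range_eq_top.1 hεr
            exact_zero := ?_
            exact_succ := fun i => ?_ }, fun i v j => ?_⟩
  · rw [LinearMap.exact_iff, hεk, hdr]
  · rw [LinearMap.exact_iff, hdk, hdr]
  · exact (hP i).2 _ (hdr i ▸ LinearMap.mem_range_self _ v) j

end Existence

/-! ### Minimal resolutions of homogeneous ideals -/

section IdealResolution

variable {K : Type*} [Field K] {n : ℕ}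

/-- `J` contains the homogeneous components of its elements. -/
def IsGradedIdeal (J : Ideal (MvPolynomial (Fin n) K)) : Prop :=
  ∀ (a : ℤ), ∀ f ∈ J, weightedHomogeneousComponent (fun _ : Fin n => (1 : ℤ)) a f ∈ J

theorem weight_one_int {σ : Type*} (d : σ →₀ ℕ) :
    Finsupp.weight (fun _ : σ => (1 : ℤ)) d = d.degree := by
  simp [Finsupp.weight_apply, Finsupp.sum, Finsupp.degree_apply]

theorem weight_one_eq_zero {σ : Type*} (d : σ →₀ ℕ)
    (hd : Finsupp.weight (fun _ : σ => (1 : ℤ)) d = 0) : d = 0 := by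
  rw [weight_one_int] at hd
  exact (Finsupp.degree_eq_zero_iff d).1 (by exact_mod_cast hd)

/-- The homogeneous components of the elements of a graded ideal. -/
def idealProj {J : Ideal (MvPolynomial (Fin n) K)} (hJ : IsGradedIdeal J) (a : ℤ) : J →+ J where
  toFun f := ⟨weightedHomogeneousComponent (fun _ : Fin n => (1 : ℤ)) a f.1, hJ a f.1 f.2⟩
  map_zero' := by ext1; simp
  map_add' f g := by ext1; simp

theorem gradingProj_ideal {J : Ideal (MvPolynomial (Fin n) K)} (hJ : IsGradedIdeal J) :
    GradingProj (K := K) (fun _ : Fin n => (1 : ℤ)) (idealDegree J) (idealProj hJ) where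
  smul_mem hf hm := hf.mul hm
  proj_of_mem hm := Subtype.ext (IsWeightedHomogeneous.weightedHomogeneousComponent_same hm)
  proj_of_ne hm hab :=
    Subtype.ext (IsWeightedHomogeneous.weightedHomogeneousComponent_ne _ hm hab)
  proj_mem _ _ := weightedHomogeneousComponent_isWeightedHomogeneous _ _

theorem IsGradedIdeal.exists_isMinimal {J : Ideal (MvPolynomial (Fin n) K)}
    (hJ : IsGradedIdeal J) :
    ∃ F : GradedFreeResolution (K := K) (fun _ : Fin n => (1 : ℤ)) (idealDegree J),
      F.IsMinimal := by
  refine (gradingProj_ideal hJ).exists_isMinimal weight_one_eq_zero fun m => ?_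
  -- The decomposition into components takes place in `S`, seen as a free module of rank one, and is
  -- pulled back along the injection `J → S`.
  have h := mem_span_range_freeProj (K := K) (w := fun _ : Fin n => (1 : ℤ))
    (fun _ : Unit => (0 : ℤ)) (fun _ => m.1)
  have h2 := Submodule.mem_map_of_mem
    (f := LinearMap.proj (R := MvPolynomial (Fin n) K) (φ := fun _ : Unit => _) ()) h
  rw [Submodule.map_span, ← Set.range_comp] at h2
  suffices J.subtype m ∈ (Submodule.span _ (Set.range fun a => idealProj hJ a m)).map J.subtype by
    obtain ⟨x, hx, hxm⟩ := this
    exact J.injective_subtype hxm ▸ hx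
  rw [Submodule.map_span, ← Set.range_comp]
  have hcomp : (J.subtype ∘ fun a => idealProj hJ a m) =
      LinearMap.proj (R := MvPolynomial (Fin n) K) (φ := fun _ : Unit => MvPolynomial (Fin n) K) () ∘
        fun a => freeProj K (fun _ : Fin n => (1 : ℤ)) (fun _ : Unit => (0 : ℤ)) a
          fun _ => m.1 := by
    ext1 a
    simp [idealProj, freeProj]
  rw [hcomp]
  exact h2

end IdealResolution

/-! ## Powers of monomial prime ideals -/

section MonomialPrime

variable {K : Type*} [Field K] {n : ℕ} {P : Ideal (MvPolynomial (Fin n) K)}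

open Classical in
/-- The weight that counts the variables contained in `P`. -/
def primeWeight (P : Ideal (MvPolynomial (Fin n) K)) (i : Fin n) : ℕ :=
  if X i ∈ P then 1 else 0

theorem monomial_mem_pow_weight (P : Ideal (MvPolynomial (Fin n) K)) (a : Fin n →₀ ℕ) :
    monomial a (1 : K) ∈ P ^ Finsupp.weight (primeWeight P) a := by
  induction a using Finsupp.induction_linear with
  | zero => simp
  | add a b ha hb =>
    rw [map_add, pow_add, ← one_mul (1 : K), ← monomial_mul]
    exact Ideal.mul_mem_mul ha hb
  | single i m =>
    rw [Finsupp.weight_single, primeWeight, ← X_pow_eq_monomial]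
    split_ifs with h
    · simpa using Ideal.pow_mem_pow h m
    · simp

theorem one_le_weight_of_mem (hP : P.IsPrime) (hM : IsMonomialIdeal P)
    {f : MvPolynomial (Fin n) K} (hf : f ∈ P) {a : Fin n →₀ ℕ} (ha : a ∈ f.support) :
    1 ≤ Finsupp.weight (primeWeight P) a := by
  obtain ⟨E, hE⟩ := hM
  have hf' := hf
  rw [hE, mem_ideal_span_monomial_image] at hf'
  obtain ⟨b, hb, hba⟩ := hf' a ha
  have hbP : monomial b (1 : K) ∈ P := by
    rw [hE]
    exact Ideal.subset_span ⟨b, hb, rfl⟩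
  have hX : ∃ i, i ∈ b.support ∧ X i ∈ P := by
    rw [monomial_eq, C_1, one_mul, Finsupp.prod, hP.prod_mem_iff] at hbP
    obtain ⟨i, hi, h⟩ := hbP
    exact ⟨i, hi, hP.mem_of_pow_mem _ h⟩
  obtain ⟨i, hi, hiP⟩ := hX
  have hw : primeWeight P i = 1 := if_pos hiP
  have hai : a i ≠ 0 := fun h => by
    have := hba i
    rw [h] at this
    exact Finsupp.mem_support_iff.1 hi (Nat.le_zero.1 this)
  exact hw.symm.le.trans (Finsupp.le_weight_of_ne_zero' (primeWeight P) hai)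

/-- Weights add under multiplication, which gives one direction by induction on `e`; conversely
`x^a` lies in the power of `P` given by its own weight. -/
theorem mem_pow_iff_le_weight (hP : P.IsPrime) (hM : IsMonomialIdeal P) (e : ℕ)
    (f : MvPolynomial (Fin n) K) :
    f ∈ P ^ e ↔ ∀ a ∈ f.support, e ≤ Finsupp.weight (primeWeight P) a := by
  classical
  constructor
  · intro hf
    induction e generalizing f with
    | zero => simp
    | succ e ih =>
      rw [pow_succ] at hf
      induction hf using Submodule.mul_induction_on' with
      | mem_mul_mem g hg h hh =>
        intro a ha
        obtain ⟨b, hb, c, hc, rfl⟩ := Finset.mem_add.1 (support_mul _ _ ha)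
        rw [map_add]
        exact add_le_add (ih g hg b hb) (one_le_weight_of_mem hP hM hh hc)
      | add g _ h _ hg hh =>
        intro a ha
        rcases Finset.mem_union.1 (support_add ha) with ha | ha
        exacts [hg a ha, hh a ha]
  · intro hf
    rw [f.as_sum]
    refine Ideal.sum_mem _ fun a ha => ?_
    rw [← mul_one (coeff a f), ← C_mul_monomial]
    exact Ideal.mul_mem_left _ _ (Ideal.pow_le_pow_right (hf a ha) (monomial_mem_pow_weight P a))

/-- The powers of a monomial prime ideal are primary. -/
theorem mem_pow_of_mul_mem_pow (hP : P.IsPrime) (hM : IsMonomialIdeal P) {e : ℕ}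
    {s f : MvPolynomial (Fin n) K} (hs : s ∉ P) (h : s * f ∈ P ^ e) : f ∈ P ^ e := by
  classical
  by_contra hf
  rw [← pow_one P, mem_pow_iff_le_weight hP hM] at hs
  rw [mem_pow_iff_le_weight hP hM] at hf h
  generalize primeWeight P = w at hs hf h
  push Not at hs hf
  obtain ⟨b, hb, hb'⟩ := hs
  have hb0 : Finsupp.weight w b = 0 := by omega
  obtain ⟨a₀, ha₀, ha₀e⟩ := hf
  obtain ⟨a, ha, hmin⟩ := Finset.exists_min_image f.support (Finsupp.weight w) ⟨a₀, ha₀⟩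
  have hae : Finsupp.weight w a < e := (hmin a₀ ha₀).trans_lt ha₀e
  -- The lowest component of `s * f` is the product of the lowest components, those of `s` in weight
  -- 0 (as `s ∉ P`) and of `f` in weight below `e`. Both are nonzero, but weights below `e` do not
  -- occur in `P ^ e`.
  have key : weightedHomogeneousComponent w (Finsupp.weight w a) (s * f) =
      weightedHomogeneousComponent w 0 s *
        weightedHomogeneousComponent w (Finsupp.weight w a) f := by
    ext d
    rw [coeff_weightedHomogeneousComponent, coeff_mul, coeff_mul]
    split_ifs with hd
    · refine Finset.sum_congr rfl fun x hx => ?_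
      have hx' := congrArg (Finsupp.weight w) (Finset.HasAntidiagonal.mem_antidiagonal.1 hx)
      rw [map_add, hd] at hx'
      rw [coeff_weightedHomogeneousComponent, coeff_weightedHomogeneousComponent]
      by_cases hx2 : x.2 ∈ f.support
      · have := hmin _ hx2
        rw [if_pos (by omega), if_pos (by omega)]
      · rw [notMem_support_iff.1 hx2]
        simp
    · refine (Finset.sum_eq_zero fun x hx => ?_).symm
      have hx' := congrArg (Finsupp.weight w) (Finset.HasAntidiagonal.mem_antidiagonal.1 hx)
      rw [map_add] at hx'
      rw [coeff_weightedHomogeneousComponent, coeff_weightedHomogeneousComponent]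
      by_cases h1 : Finsupp.weight w x.1 = 0
      · rw [if_neg (c := Finsupp.weight w x.2 = _) (by omega), mul_zero]
      · rw [if_neg h1, zero_mul]
  have hzero : weightedHomogeneousComponent w (Finsupp.weight w a) (s * f) = 0 := by
    refine weightedHomogeneousComponent_eq_zero' _ _ fun d hd hda => ?_
    have := h d hd
    omega
  rw [hzero, eq_comm, mul_eq_zero] at key
  rcases key with key | key
  · have := congrArg (coeff b) key
    rw [coeff_weightedHomogeneousComponent, if_pos hb0] at this
    exact mem_support_iff.1 hb (by simpa using this)
  · have := congrArg (coeff a) key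
    rw [coeff_weightedHomogeneousComponent, if_pos rfl] at this
    exact mem_support_iff.1 ha (by simpa using this)

end MonomialPrime

/-! ## Symbolic powers -/

section SymbolicPowers

theorem mem_symbolicPower_iff {R : Type*} [CommRing R] [IsNoetherianRing R] {I : Ideal R} {k : ℕ}
    {f : R} : f ∈ symbolicPower I k ↔
      ∀ P ∈ associatedPrimes R (R ⧸ I), ∃ s ∉ P, s * f ∈ I ^ k := by
  simp only [symbolicPower, Ideal.mem_iInf, Ideal.mem_comap, Subtype.forall]
  refine forall₂_congr fun P hP => ?_
  have : P.IsPrime := hP.isPrime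
  rw [IsLocalization.algebraMap_mem_map_algebraMap_iff P.primeCompl]
  rfl

/-- If `f ∉ I`, the annihilator of `f` modulo `I` lies in some associated prime `P`, so no `s ∉ P`
can satisfy `s * f ∈ I`. -/
theorem symbolicPower_one {R : Type*} [CommRing R] [IsNoetherianRing R] (I : Ideal R) :
    symbolicPower I 1 = I := by
  ext f
  rw [mem_symbolicPower_iff]
  constructor
  · intro h
    by_contra hf
    have hne : (Ideal.Quotient.mk I f) ≠ 0 := fun h0 => hf (Ideal.Quotient.eq_zero_iff_mem.1 h0)
    obtain ⟨P, hP, hle⟩ := exists_le_isAssociatedPrime_of_isNoetherianRing R _ hne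
    obtain ⟨s, hs, hsf⟩ := h P hP
    refine hs (hle ?_)
    rw [Submodule.mem_colon_singleton, Submodule.mem_bot, Algebra.smul_def,
      Ideal.Quotient.algebraMap_eq, ← map_mul, Ideal.Quotient.eq_zero_iff_mem]
    simpa using hsf
  · intro hf P hP
    exact ⟨1, (Ideal.ne_top_iff_one P).1 hP.isPrime.ne_top, by simpa using hf⟩

theorem symbolicPower_bot {R : Type*} [CommRing R] [IsNoetherianRing R] {k : ℕ} (hk : 1 ≤ k) :
    symbolicPower (⊥ : Ideal R) k = ⊥ ^ k := by
  have hk' : (⊥ : Ideal R) ^ k = ⊥ := Ideal.bot_pow (by omega)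
  conv_rhs => rw [hk', ← symbolicPower_one (⊥ : Ideal R)]
  ext f
  simp only [mem_symbolicPower_iff, hk', pow_one]

variable {K : Type*} [Field K] {n : ℕ} {I : Ideal (MvPolynomial (Fin n) K)}

/-- The symbolic powers of an ideal of minimal intersection type are described by the weights of
exponents at the associated primes. -/
theorem IsMinimalIntersectionType.exists_mem_symbolicPower_iff
    (hI : IsMinimalIntersectionType I) :
    ∃ e : Ideal (MvPolynomial (Fin n) K) → ℕ, ∀ (k : ℕ) (f : MvPolynomial (Fin n) K),
      f ∈ symbolicPower I k ↔ ∀ a ∈ f.support,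
        ∀ P ∈ associatedPrimes (MvPolynomial (Fin n) K) (MvPolynomial (Fin n) K ⧸ I),
          k * e P ≤ Finsupp.weight (primeWeight P) a := by
  classical
  obtain ⟨⟨m, Q, e, hQ, hIQ⟩, hmin⟩ := hI
  have hIQ' : ∀ f, f ∈ I ↔ ∀ i, f ∈ Q i ^ e i := fun f => by rw [hIQ, Ideal.mem_iInf]
  -- Write `P` as the annihilator of `y` modulo `I`. The components not containing `y` intersect
  -- inside `P`, so one such `Q i` lies in `P`; equality follows because `Q i ^ e i` is primary.
  have hass : ∀ P ∈ associatedPrimes (MvPolynomial (Fin n) K) (MvPolynomial (Fin n) K ⧸ I),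
      ∃ i, P = Q i := by
    intro P hP
    obtain ⟨hPp, x, hx⟩ := isAssociatedPrime_iff.1 hP
    obtain ⟨y, rfl⟩ := Ideal.Quotient.mk_surjective x
    have hPy : ∀ g, g ∈ P ↔ ∀ i, g * y ∈ Q i ^ e i := by
      intro g
      rw [← hIQ', hx, Submodule.mem_colon_singleton, Submodule.mem_bot,
        ← Ideal.Quotient.eq_zero_iff_mem]
      rfl
    have hle : (Finset.univ.filter fun i => y ∉ Q i ^ e i).inf (fun i => Q i ^ e i) ≤ P := by
      intro g hg
      rw [hPy]
      intro i
      by_cases hy : y ∈ Q i ^ e i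
      · exact Ideal.mul_mem_left _ _ hy
      · rw [Submodule.mem_finsetInf] at hg
        exact Ideal.mul_mem_right _ _ (hg i (by simp [hy]))
    obtain ⟨i, hi, hiP⟩ := (Ideal.IsPrime.inf_le' hPp).1 hle
    refine ⟨i, le_antisymm (fun g hg => ?_) (Ideal.IsPrime.le_of_pow_le hiP)⟩
    by_contra hgi
    exact (Finset.mem_filter.1 hi).2
      (mem_pow_of_mul_mem_pow (hQ i).1 (hQ i).2.1 hgi ((hPy g).1 hg i))
  -- `Q i` contains a minimal prime of `I`, which is associated; the absence of embedded primes
  -- forces it to be `P`.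
  have heq : ∀ P ∈ associatedPrimes (MvPolynomial (Fin n) K) (MvPolynomial (Fin n) K ⧸ I),
      ∀ i, Q i ≤ P → Q i = P := by
    intro P hP i hi
    have := (hQ i).1
    have hIi : I ≤ Q i := fun f hf =>
      Ideal.pow_le_self (Nat.one_le_iff_ne_zero.1 (hQ i).2.2) ((hIQ' f).1 hf i)
    obtain ⟨p, hp, hpi⟩ := Ideal.exists_minimalPrimes_le hIi
    have hp' : p ∈ associatedPrimes (MvPolynomial (Fin n) K) (MvPolynomial (Fin n) K ⧸ I) := by
      apply Module.associatedPrimes.minimalPrimes_annihilator_subset_associatedPrimes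
      rwa [Ideal.annihilator_quotient]
    exact le_antisymm hi (hmin p hp' P hP (hpi.trans hi) ▸ hpi)
  -- A prime may occur several times in the intersection; only its largest exponent matters.
  refine ⟨fun P => (Finset.univ.filter fun i => Q i = P).sup e, fun k f => ?_⟩
  rw [mem_symbolicPower_iff]
  have hloc : ∀ P ∈ associatedPrimes (MvPolynomial (Fin n) K) (MvPolynomial (Fin n) K ⧸ I),
      ((∃ s ∉ P, s * f ∈ I ^ k) ↔ ∀ a ∈ f.support,
        k * (Finset.univ.filter fun i => Q i = P).sup e ≤ Finsupp.weight (primeWeight P) a) := by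
    intro P hP
    obtain ⟨i₀, rfl⟩ := hass P hP
    set P := Q i₀
    have hPp : P.IsPrime := (hQ i₀).1
    have hPm : IsMonomialIdeal P := (hQ i₀).2.1
    set E := (Finset.univ.filter fun i => Q i = P).sup e
    rw [← mem_pow_iff_le_weight hPp hPm]
    constructor
    · rintro ⟨s, hs, hsf⟩
      refine mem_pow_of_mul_mem_pow hPp hPm hs ?_
      have hIE : I ≤ P ^ E := by
        obtain ⟨i, hi, hiE⟩ := Finset.exists_mem_eq_sup (Finset.univ.filter fun i => Q i = P)
          ⟨i₀, by simp [P]⟩ e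
        intro g hg
        have := (hIQ' g).1 hg i
        rwa [(Finset.mem_filter.1 hi).2, ← hiE] at this
      have := Ideal.pow_right_mono hIE k hsf
      rwa [← pow_mul, mul_comm] at this
    · intro hf
      -- Some `s ∉ P` lies in all components whose prime is not inside `P`. Then `s P^E ⊆ I`, and `s
      -- ^ k` serves for the `k`-th power.
      have hs : ¬ (Finset.univ.filter fun i => ¬ Q i ≤ P).inf (fun i => Q i ^ e i) ≤ P := by
        intro h
        obtain ⟨i, hi, hiP⟩ := (Ideal.IsPrime.inf_le' hPp).1 h
        exact (Finset.mem_filter.1 hi).2 (Ideal.IsPrime.le_of_pow_le hiP)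
      obtain ⟨s, hs, hsP⟩ := SetLike.not_le_iff_exists.1 hs
      have hsI : Ideal.span {s} * P ^ E ≤ I := by
        rw [Ideal.span_singleton_mul_le_iff]
        intro g hg
        rw [hIQ']
        intro i
        by_cases hi : Q i ≤ P
        · have hiP := heq P hP i hi
          rw [hiP]
          exact Ideal.mul_mem_left _ _ (Ideal.pow_le_pow_right
            (Finset.le_sup (f := e) (by simp [hiP])) hg)
        · rw [Submodule.mem_finsetInf] at hs
          exact Ideal.mul_mem_right _ _ (hs i (by simp [hi]))
      refine ⟨s ^ k, fun h => hsP (hPp.mem_of_pow_mem k h), ?_⟩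
      have h := Ideal.pow_right_mono hsI k
      rw [mul_pow, Ideal.span_singleton_pow, ← pow_mul, Ideal.span_singleton_mul_le_iff] at h
      exact h f (by rwa [mul_comm])
  exact ⟨fun h a ha P hP => (hloc P hP).1 (h P hP) a ha,
    fun h P hP => (hloc P hP).2 fun a ha => h a ha P hP⟩

theorem IsMinimalIntersectionType.mem_symbolicPower_iff_forall_monomial
    (hI : IsMinimalIntersectionType I) (k : ℕ) (f : MvPolynomial (Fin n) K) :
    f ∈ symbolicPower I k ↔ ∀ a ∈ f.support, monomial a (1 : K) ∈ symbolicPower I k := by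
  classical
  obtain ⟨e, he⟩ := hI.exists_mem_symbolicPower_iff
  simp [he, support_monomial]

theorem IsMinimalIntersectionType.isGradedIdeal_symbolicPower
    (hI : IsMinimalIntersectionType I) (k : ℕ) : IsGradedIdeal (symbolicPower I k) := by
  classical
  intro a f hf
  rw [hI.mem_symbolicPower_iff_forall_monomial] at hf ⊢
  intro d hd
  rw [support_weightedHomogeneousComponent] at hd
  exact hf d (Finset.mem_filter.1 hd).1

/-- If `x_i` divides the minimal generator `x^a`, dividing by `x_i` violates the inequality of some
`P` containing `x_i`, so that inequality is tight at `a`. It stays tight at `k • a`, and a divisor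
of `x^(k • a)` with smaller `i`-th exponent violates it. -/
theorem IsMinimalIntersectionType.pow_mem_minimalGenerators
    (hI : IsMinimalIntersectionType I) {u : MvPolynomial (Fin n) K} (hu : u ∈ minimalGenerators I)
    (k : ℕ) : u ^ k ∈ minimalGenerators (symbolicPower I k) := by
  classical
  obtain ⟨e, he⟩ := hI.exists_mem_symbolicPower_iff
  have hmon : ∀ k (a : Fin n →₀ ℕ), monomial a (1 : K) ∈ symbolicPower I k ↔
      ∀ P ∈ associatedPrimes (MvPolynomial (Fin n) K) (MvPolynomial (Fin n) K ⧸ I),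
        k * e P ≤ Finsupp.weight (primeWeight P) a := by
    intro k a
    simp [he, support_monomial]
  obtain ⟨a, rfl, ha, hamin⟩ := hu
  rw [← symbolicPower_one I, hmon] at ha
  refine ⟨k • a, by rw [monomial_pow, one_pow], ?_, fun b hb hba => ?_⟩
  · rw [monomial_pow, one_pow, hmon]
    intro P hP
    rw [map_nsmul, smul_eq_mul]
    exact Nat.mul_le_mul_left k (by simpa using ha P hP)
  · ext i
    by_contra hne
    have hlt : b i < k * a i := lt_of_le_of_ne (by simpa using hba i) (by simpa using hne)
    have hai : Finsupp.single i 1 ≤ a := by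
      rw [Finsupp.single_le_iff]
      exact Nat.pos_of_ne_zero fun h => by simp [h] at hlt
    obtain ⟨a', rfl⟩ := exists_add_of_le hai
    have hnot : monomial a' (1 : K) ∉ symbolicPower I 1 := by
      rw [symbolicPower_one]
      intro h
      have := congrArg (· i) (hamin a' h (by simp))
      simp at this
    rw [hmon] at hnot
    push Not at hnot
    obtain ⟨P, hP, hlt'⟩ := hnot
    have h1 := ha P hP
    rw [map_add, Finsupp.weight_single] at h1
    have hXi : primeWeight P i = 1 := by
      by_cases hX : X i ∈ P
      · exact if_pos hX
      · have h0 : primeWeight P i = 0 := if_neg hX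
        rw [h0, smul_zero, zero_add] at h1
        omega
    have hbP := (hmon k b).1 hb P hP
    obtain ⟨c, hc⟩ := exists_add_of_le hba
    have hci : c i ≠ 0 := fun h => by
      have := DFunLike.congr_fun hc i
      rw [Finsupp.add_apply, h, Finsupp.smul_apply, smul_eq_mul] at this
      omega
    have hcw := Finsupp.le_weight_of_ne_zero' (primeWeight P) hci
    have hw := congrArg (Finsupp.weight (primeWeight P)) hc
    rw [map_nsmul, map_add, map_add, Finsupp.weight_single, hXi, smul_eq_mul, smul_eq_mul,
      one_mul] at hw
    rw [hXi, smul_eq_mul, one_mul] at h1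
    rw [hXi] at hcw
    have hEq : 1 + Finsupp.weight (primeWeight P) a' = e P := by omega
    rw [hEq] at hw
    omega

end SymbolicPowers

/-! ## Regularity and degrees of generators -/

section Regularity

variable {K : Type*} [Field K] {n : ℕ}

theorem weight_one_nat {σ : Type*} (d : σ →₀ ℕ) : Finsupp.weight (1 : σ → ℕ) d = d.degree := by
  simp [Finsupp.weight_apply, Finsupp.sum, Finsupp.degree_apply]

theorem isHomogeneous_iff_int {f : MvPolynomial (Fin n) K} {d : ℕ} :
    f.IsHomogeneous d ↔ IsWeightedHomogeneous (fun _ : Fin n => (1 : ℤ)) f (d : ℤ) := by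
  refine forall₂_congr fun a _ => ?_
  rw [weight_one_int, weight_one_nat, Nat.cast_inj]

/-- Take a homogeneous preimage of `f` under `ε`. If no shift equals `d`, its coefficients have
nonzero degree, hence no constant term, and `f` would lie in `𝔪 J`. -/
theorem GradedFreeResolution.exists_shift_eq {J : Ideal (MvPolynomial (Fin n) K)}
    (hJ : IsGradedIdeal J)
    (F : GradedFreeResolution (K := K) (fun _ : Fin n => (1 : ℤ)) (idealDegree J))
    {f : MvPolynomial (Fin n) K} (hfJ : f ∈ J) {d : ℕ} (hf : f.IsHomogeneous d)
    (hfm : f ∉ Ideal.span (Set.range (X : Fin n → MvPolynomial (Fin n) K)) * J) :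
    ∃ j, F.shift 0 j = d := by
  by_contra! hne
  obtain ⟨z, hz, hzf⟩ := (gradingProj_ideal hJ).exists_homogeneous_preimage (l := F.ε)
    F.ε_homogeneous (m := ⟨f, hfJ⟩) (isHomogeneous_iff_int.1 hf) (F.ε_surjective _)
  have hsum := congrArg Subtype.val hzf
  rw [apply_eq_sum_smul_single F.ε z, AddSubmonoidClass.coe_finsetSum] at hsum
  replace hsum : ∑ j, z j * (F.ε (Pi.single j 1) : MvPolynomial (Fin n) K) = f := hsum
  refine hfm (hsum ▸ Ideal.sum_mem _ fun j _ => Ideal.mul_mem_mul ?_ (Subtype.mem _))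
  rw [mem_span_range_X_iff]
  refine (hz j).coeff_eq_zero _ ?_
  rw [map_zero]
  exact fun h => hne j (sub_eq_zero.1 h.symm).symm

theorem IsGradedIdeal.mem_idealShifts_zero {J : Ideal (MvPolynomial (Fin n) K)}
    (hJ : IsGradedIdeal J) {f : MvPolynomial (Fin n) K} (hfJ : f ∈ J) {d : ℕ}
    (hf : f.IsHomogeneous d)
    (hfm : f ∉ Ideal.span (Set.range (X : Fin n → MvPolynomial (Fin n) K)) * J) :
    (d : ℤ) ∈ idealShifts J 0 := by
  obtain ⟨F, hF⟩ := hJ.exists_isMinimal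
  exact ⟨F, hF, F.exists_shift_eq hJ hfJ hf hfm⟩

theorem le_reg {J : Ideal (MvPolynomial (Fin n) K)} {i : ℕ} {a : ℤ} (ha : a ∈ idealShifts J i) :
    (((a - i : ℤ) : ℝ) : EReal) ≤ reg J :=
  le_iSup_of_le i (le_iSup₂_of_le a ha le_rfl)

theorem reg_le {J : Ideal (MvPolynomial (Fin n) K)} {c : EReal}
    (h : ∀ i, ∀ a ∈ idealShifts J i, (((a - i : ℤ) : ℝ) : EReal) ≤ c) : reg J ≤ c :=
  iSup_le fun i => iSup₂_le fun a ha => h i a ha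

theorem le_finalDegree {J : Ideal (MvPolynomial (Fin n) K)} {f : MvPolynomial (Fin n) K}
    (hfJ : f ∈ J) {d : ℕ} (hf : f.IsHomogeneous d)
    (hfm : f ∉ Ideal.span (Set.range (X : Fin n → MvPolynomial (Fin n) K)) * J) :
    (d : EReal) ≤ finalDegree J :=
  le_iSup₂_of_le d ⟨f, hfJ, hf, hfm⟩ le_rfl

theorem IsGradedIdeal.finalDegree_le_reg {J : Ideal (MvPolynomial (Fin n) K)}
    (hJ : IsGradedIdeal J) : finalDegree J ≤ reg J := by
  refine iSup₂_le ?_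
  rintro d ⟨f, hfJ, hf, hfm⟩
  refine le_trans (le_of_eq ?_) (le_reg (hJ.mem_idealShifts_zero hfJ hf hfm))
  simp

end Regularity

/-! ## Minimal generators of monomial ideals -/

section MonomialIdeals

variable {K : Type*} [Field K] {n : ℕ} {J : Ideal (MvPolynomial (Fin n) K)}

/-- Turns a witness for `ω(J)` into a minimal monomial generator of the same degree: the nonminimal
monomials of `f` lie in `𝔪 J`. -/
theorem exists_mem_minimalGenerators (hJ : ∀ f, f ∈ J ↔ ∀ a ∈ f.support, monomial a (1 : K) ∈ J)
    {f : MvPolynomial (Fin n) K} (hf : f ∈ J)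
    (hfm : f ∉ Ideal.span (Set.range (X : Fin n → MvPolynomial (Fin n) K)) * J) :
    ∃ a ∈ f.support, monomial a (1 : K) ∈ minimalGenerators J := by
  classical
  by_contra! hne
  refine hfm ?_
  rw [f.as_sum]
  refine Ideal.sum_mem _ fun a ha => ?_
  have haJ := (hJ f).1 hf a ha
  have h : ∃ b, monomial b (1 : K) ∈ J ∧ b ≤ a ∧ b ≠ a := by
    by_contra! h
    exact hne a ha ⟨a, rfl, haJ, h⟩
  obtain ⟨b, hb, hba, hne'⟩ := h
  obtain ⟨c, rfl⟩ := exists_add_of_le hba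
  have hc : c ≠ 0 := by
    rintro rfl
    simp at hne'
  rw [add_comm b c, ← mul_one (coeff _ f), ← monomial_mul]
  refine Ideal.mul_mem_mul ?_ hb
  rw [mem_span_range_X_iff, coeff_monomial, if_neg hc]

theorem notMem_of_mem_minimalGenerators
    (hJ : ∀ f, f ∈ J ↔ ∀ a ∈ f.support, monomial a (1 : K) ∈ J) {a : Fin n →₀ ℕ}
    (ha : monomial a (1 : K) ∈ minimalGenerators J) :
    monomial a (1 : K) ∉ Ideal.span (Set.range (X : Fin n → MvPolynomial (Fin n) K)) * J := by
  classical
  obtain ⟨a', ha', -, hmin⟩ := ha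
  obtain rfl : a = a' := monomial_left_injective one_ne_zero ha'
  intro hmem
  have key : ∀ f ∈ Ideal.span (Set.range (X : Fin n → MvPolynomial (Fin n) K)) * J,
      ∀ d ∈ f.support, ∃ b, monomial b (1 : K) ∈ J ∧ b ≤ d ∧ b ≠ d := by
    intro f hf
    induction hf using Submodule.mul_induction_on' with
    | mem_mul_mem x hx y hy =>
      intro d hd
      obtain ⟨c, hc, b, hb, rfl⟩ := Finset.mem_add.1 (support_mul _ _ hd)
      refine ⟨b, (hJ y).1 hy b hb, by simp, fun h => ?_⟩
      have : c = 0 := by simpa using h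
      subst this
      exact mem_support_iff.1 hc ((mem_span_range_X_iff x).1 hx)
    | add x _ y _ hx hy =>
      intro d hd
      rcases Finset.mem_union.1 (support_add hd) with hd | hd
      exacts [hx d hd, hy d hd]
  obtain ⟨b, hb, hba, hne⟩ := key _ hmem a (by simp [support_monomial])
  exact hne (hmin b hb hba)

theorem IsMinimalIntersectionType.finalDegree_mul_le (hJ : IsMinimalIntersectionType J) {k : ℕ}
    (hk : 1 ≤ k) : finalDegree J * (k : EReal) ≤ finalDegree (symbolicPower J k) := by
  have hJ1 := hJ.mem_symbolicPower_iff_forall_monomial 1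
  rw [symbolicPower_one] at hJ1
  have hk0 : (0 : EReal) < (k : EReal) := by exact_mod_cast hk
  -- Dividing by `k` isolates the supremum, which is then bounded termwise; the empty supremum is
  -- included.
  rw [← EReal.le_div_iff_mul_le hk0 (EReal.natCast_ne_top k)]
  refine iSup₂_le ?_
  rintro d ⟨f, hfJ, hf, hfm⟩
  rw [EReal.le_div_iff_mul_le hk0 (EReal.natCast_ne_top k)]
  obtain ⟨a, ha, hagen⟩ := exists_mem_minimalGenerators hJ1 hfJ hfm
  have hu := hJ.pow_mem_minimalGenerators hagen k
  rw [monomial_pow, one_pow] at hu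
  have hdeg : (monomial (k • a) (1 : K)).IsHomogeneous (d * k) := by
    refine isHomogeneous_monomial _ ?_
    have := hf (mem_support_iff.1 ha)
    rw [weight_one_nat] at this
    rw [map_nsmul, this, smul_eq_mul, mul_comm]
  have hmem : monomial (k • a) (1 : K) ∈ symbolicPower J k := by
    obtain ⟨_, -, h, -⟩ := hu
    exact h
  have := le_finalDegree hmem hdeg (notMem_of_mem_minimalGenerators
    (hJ.mem_symbolicPower_iff_forall_monomial k) hu)
  exact_mod_cast this

end MonomialIdeals

/-! ## Ideals generated in one degree -/

section GeneratedInDegree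

variable {K : Type*} [Field K] {n : ℕ} {J J' : Ideal (MvPolynomial (Fin n) K)}

/-- `J` is generated by homogeneous polynomials of degree `d`. -/
def IsGeneratedInDegree (J : Ideal (MvPolynomial (Fin n) K)) (d : ℕ) : Prop :=
  ∃ B : Set (MvPolynomial (Fin n) K), (∀ f ∈ B, f.IsHomogeneous d) ∧ J = Ideal.span B

open Pointwise in
theorem IsGeneratedInDegree.mul {d d' : ℕ} (hJ : IsGeneratedInDegree J d)
    (hJ' : IsGeneratedInDegree J' d') : IsGeneratedInDegree (J * J') (d + d') := by
  obtain ⟨B, hB, rfl⟩ := hJ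
  obtain ⟨B', hB', rfl⟩ := hJ'
  refine ⟨B * B', ?_, Ideal.span_mul_span' _ _⟩
  rintro _ ⟨f, hf, g, hg, rfl⟩
  exact (hB f hf).mul (hB' g hg)

theorem IsGeneratedInDegree.pow {d : ℕ} (hJ : IsGeneratedInDegree J d) (k : ℕ) :
    IsGeneratedInDegree (J ^ k) (d * k) := by
  induction k with
  | zero =>
    refine ⟨{1}, fun f hf => ?_, by simp⟩
    rw [Set.mem_singleton_iff.1 hf]
    exact isHomogeneous_one _ _
  | succ k ih =>
    rw [pow_succ, mul_add, mul_one]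
    exact ih.mul hJ

theorem IsGeneratedInDegree.isGradedIdeal {d : ℕ} (hJ : IsGeneratedInDegree J d) :
    IsGradedIdeal J := by
  classical
  obtain ⟨B, hB, rfl⟩ := hJ
  intro a f hf
  induction hf using Submodule.span_induction generalizing a with
  | mem f hf =>
    rw [weightedHomogeneousComponent_of_mem (isHomogeneous_iff_int.1 (hB f hf))]
    split_ifs
    exacts [Ideal.subset_span hf, zero_mem _]
  | zero => simp
  | add f g _ _ hf hg => simpa using add_mem (hf a) (hg a)
  | smul g f _ hf =>
    rw [smul_eq_mul]
    induction g using MvPolynomial.induction_on' with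
    | add g g' hg hg' => rw [add_mul, map_add]; exact add_mem hg hg'
    | monomial b c =>
      rw [mul_comm, weightedHomogeneousComponent_mul_right
        (isWeightedHomogeneous_monomial _ b c rfl)]
      exact Ideal.mul_mem_right _ _ (hf _)

/-- A nonzero generator has only terms of degree `d`, whereas `𝔪 J ⊆ 𝔪 ^ (d + 1)`. -/
theorem IsGeneratedInDegree.exists_notMem {d : ℕ} (hJ : IsGeneratedInDegree J d) (h0 : J ≠ ⊥) :
    ∃ f ∈ J, f.IsHomogeneous d ∧
      f ∉ Ideal.span (Set.range (X : Fin n → MvPolynomial (Fin n) K)) * J := by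
  obtain ⟨B, hB, rfl⟩ := hJ
  have hex : ∃ f ∈ B, f ≠ 0 := by
    by_contra! h
    exact h0 (Ideal.span_eq_bot.2 h)
  obtain ⟨f, hfB, hf⟩ := hex
  have hdeg : ∀ g ∈ B, ∀ x ∈ g.support, x.degree = d := fun g hg x hx => by
    have := hB g hg (mem_support_iff.1 hx)
    rwa [weight_one_nat] at this
  refine ⟨f, Ideal.subset_span hfB, hB f hfB, fun hmem => ?_⟩
  have hle : Ideal.span B ≤ idealOfVars (Fin n) K ^ d := by
    rw [Ideal.span_le]
    intro g hg
    rw [SetLike.mem_coe, mem_pow_idealOfVars_iff]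
    exact fun x hx => (hdeg g hg x hx).ge
  have h1 : f ∈ idealOfVars (Fin n) K ^ (d + 1) := by
    rw [pow_succ']
    exact Ideal.mul_mono_right hle hmem
  rw [mem_pow_idealOfVars_iff] at h1
  obtain ⟨x, hx⟩ := support_nonempty.2 hf
  have := h1 x hx
  have := hdeg f hfB x hx
  omega

theorem IsGradedIdeal.exists_isGeneratedInDegree (hJ : IsGradedIdeal J)
    (hlin : HasLinearResolution J) (h0 : J ≠ ⊥) : ∃ d : ℕ, IsGeneratedInDegree J d := by
  classical
  obtain ⟨c, hc⟩ := hlin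
  obtain ⟨F, hF⟩ := hJ.exists_isMinimal
  have hs : ∀ j, F.shift 0 j = c := fun j => by
    simpa using hc 0 _ ⟨F, hF, j, rfl⟩
  set B := Set.range fun j => (F.ε (Pi.single j 1) : MvPolynomial (Fin n) K)
  have hB : J = Ideal.span B := by
    refine le_antisymm (fun f hf => ?_) (Ideal.span_le.2 ?_)
    · obtain ⟨z, hz⟩ := F.ε_surjective ⟨f, hf⟩
      have hsum := congrArg Subtype.val hz
      rw [apply_eq_sum_smul_single F.ε z, AddSubmonoidClass.coe_finsetSum] at hsum
      replace hsum : ∑ j, z j * (F.ε (Pi.single j 1) : MvPolynomial (Fin n) K) = f := hsum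
      exact hsum ▸ Ideal.sum_mem _ fun j _ =>
        Ideal.mul_mem_left _ _ (Ideal.subset_span ⟨j, rfl⟩)
    · rintro _ ⟨j, rfl⟩
      exact Subtype.mem _
  have hBc : ∀ f ∈ B, IsWeightedHomogeneous (fun _ : Fin n => (1 : ℤ)) f c := by
    rintro _ ⟨j, rfl⟩
    exact hs j ▸ F.ε_homogeneous j
  have hex : ∃ f ∈ B, f ≠ 0 := by
    by_contra! h
    exact h0 (hB ▸ Ideal.span_eq_bot.2 h)
  obtain ⟨f, hfB, hf⟩ := hex
  -- The common shift `c` is a priori an integer; a term of a nonzero generator shows that it is a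
  -- natural number.
  obtain ⟨x, hx⟩ := support_nonempty.2 hf
  have hxc := hBc f hfB (mem_support_iff.1 hx)
  rw [weight_one_int] at hxc
  refine ⟨x.degree, B, fun g hg => ?_, hB⟩
  rw [isHomogeneous_iff_int, hxc]
  exact hBc g hg

theorem IsGeneratedInDegree.reg_eq {d : ℕ} (hJ : IsGeneratedInDegree J d)
    (hlin : HasLinearResolution J) (h0 : J ≠ ⊥) :
    reg J = (d : EReal) ∧ finalDegree J = (d : EReal) := by
  obtain ⟨c, hc⟩ := hlin
  obtain ⟨f, hfJ, hf, hfm⟩ := hJ.exists_notMem h0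
  have hcd : c = d := by
    simpa using (hc 0 _ (hJ.isGradedIdeal.mem_idealShifts_zero hfJ hf hfm)).symm
  have h1 : (d : EReal) ≤ finalDegree J := le_finalDegree hfJ hf hfm
  have h2 : finalDegree J ≤ reg J := hJ.isGradedIdeal.finalDegree_le_reg
  have h3 : reg J ≤ (d : EReal) := by
    refine reg_le fun i a ha => le_of_eq ?_
    rw [hc i a ha, hcd]
    simp
  exact ⟨le_antisymm h3 (h1.trans h2), le_antisymm (h2.trans h3) h1⟩

/-- If `J` has linear powers, then `reg J ^ k = ω(J) k`. -/
theorem HasLinearPowers.reg_pow (hJ : IsGradedIdeal J) (hlin : HasLinearPowers J) (h0 : J ≠ ⊥)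
    {k : ℕ} (hk : 1 ≤ k) : reg (J ^ k) = finalDegree J * (k : EReal) := by
  have h1 : HasLinearResolution J := by simpa using hlin 1 le_rfl
  obtain ⟨d, hd⟩ := hJ.exists_isGeneratedInDegree h1 h0
  rw [(hd.reg_eq h1 h0).2, ((hd.pow k).reg_eq (hlin k hk) (pow_ne_zero k h0)).1]
  norm_cast

end GeneratedInDegree

/-! ## The symbolic Rees algebra as a bigraded module -/

section Rees

variable {K : Type*} [Field K] {n : ℕ} {I : Ideal (MvPolynomial (Fin n) K)}

/-- The symbolic Rees algebra as a module through its presentation. -/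
@[reducible]
def reesModule (I : Ideal (MvPolynomial (Fin n) K)) :
    Module (MvPolynomial (Fin n ⊕ reesGenerators I) K) (symbolicRees I) :=
  Module.compHom _ (reesPresentation I).toRingHom

/-- A shortcut instance. -/
@[reducible]
def reesSMul (I : Ideal (MvPolynomial (Fin n) K)) :
    SMul (MvPolynomial (Fin n ⊕ reesGenerators I) K) (symbolicRees I) :=
  (reesModule I).toSMul

attribute [local instance] reesModule reesSMul

theorem reesDegree_zero_mem (c : ℤ × ℤ) : (0 : symbolicRees I) ∈ reesDegree I c :=
  fun k => ⟨by simpa using isWeightedHomogeneous_zero K _ _, fun _ => by simp⟩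

theorem reesDegree_add_mem {c : ℤ × ℤ} {x y : symbolicRees I} (hx : x ∈ reesDegree I c)
    (hy : y ∈ reesDegree I c) : x + y ∈ reesDegree I c := fun k => by
  simp only [Subalgebra.coe_add, Polynomial.coeff_add]
  exact ⟨(hx k).1.add (hy k).1, fun h => by rw [(hx k).2 h, (hy k).2 h, add_zero]⟩

theorem reesDegree_mul_mem {c c' : ℤ × ℤ} {x y : symbolicRees I} (hx : x ∈ reesDegree I c)
    (hy : y ∈ reesDegree I c') : x * y ∈ reesDegree I (c + c') := fun k => by
  simp only [Subalgebra.coe_mul, Polynomial.coeff_mul]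
  refine ⟨IsWeightedHomogeneous.sum _ _ _ fun z _ => (hx z.1).1.mul (hy z.2).1,
    fun h => Finset.sum_eq_zero fun z hz => ?_⟩
  have hz' := Finset.HasAntidiagonal.mem_antidiagonal.1 hz
  by_cases h1 : (z.1 : ℤ) = c.2
  · rw [(hy z.2).2, mul_zero]
    rintro h2
    apply h
    rw [Prod.snd_add, ← h1, ← h2, ← hz', Nat.cast_add]
  · rw [(hx z.1).2 h1, zero_mul]

theorem reesDegree_algebraMap_mem {f : MvPolynomial (Fin n) K} {a : ℤ}
    (hf : IsWeightedHomogeneous (fun _ : Fin n => (1 : ℤ)) f a) :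
    algebraMap (MvPolynomial (Fin n) K) (symbolicRees I) f ∈ reesDegree I (a, 0) := fun k => by
  have : ((algebraMap (MvPolynomial (Fin n) K) (symbolicRees I) f : symbolicRees I) :
      Polynomial (MvPolynomial (Fin n) K)) = Polynomial.C f := rfl
  rw [this, Polynomial.coeff_C]
  split_ifs with h
  · exact ⟨hf, fun h' => absurd (by simp [h]) h'⟩
  · exact ⟨isWeightedHomogeneous_zero K _ _, fun _ => rfl⟩

theorem reesPresentation_X_mem (s : Fin n ⊕ reesGenerators I) :
    reesPresentation I (X s) ∈ reesDegree I (reesWeight I s) := by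
  rw [reesPresentation, aeval_X]
  cases s with
  | inl i => exact reesDegree_algebraMap_mem (isWeightedHomogeneous_X K _ i)
  | inr g =>
    intro k
    change IsWeightedHomogeneous _ ((Polynomial.monomial g.1.2
      (monomial g.1.1 (1 : K))).coeff k) _ ∧ (_ → (Polynomial.monomial g.1.2
      (monomial g.1.1 (1 : K))).coeff k = 0)
    rw [Polynomial.coeff_monomial]
    split_ifs with h
    · exact ⟨isWeightedHomogeneous_monomial _ _ _ (weight_one_int _),
        fun h' => absurd (by simp [reesWeight, h]) h'⟩
    · exact ⟨isWeightedHomogeneous_zero K _ _, fun _ => rfl⟩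

theorem reesPresentation_monomial_mem (d : Fin n ⊕ reesGenerators I →₀ ℕ) (c : K) :
    reesPresentation I (monomial d c) ∈ reesDegree I (Finsupp.weight (reesWeight I) d) := by
  have hC : ∀ c : K, reesPresentation I (C c) ∈ reesDegree I 0 := fun c => by
    rw [← algebraMap_eq, AlgHom.commutes,
      IsScalarTower.algebraMap_apply K (MvPolynomial (Fin n) K) (symbolicRees I)]
    exact reesDegree_algebraMap_mem (isWeightedHomogeneous_C _ c)
  have h1 : reesPresentation I (monomial d 1) ∈
      reesDegree I (Finsupp.weight (reesWeight I) d) := by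
    induction d using Finsupp.induction_linear with
    | zero => simpa using hC 1
    | add a b ha hb =>
      rw [map_add, ← one_mul (1 : K), ← monomial_mul, map_mul]
      exact reesDegree_mul_mem ha hb
    | single s m =>
      rw [Finsupp.weight_single, ← X_pow_eq_monomial]
      induction m with
      | zero => simpa using hC 1
      | succ m ih =>
        rw [pow_succ, map_mul, succ_nsmul]
        exact reesDegree_mul_mem ih (reesPresentation_X_mem s)
  rw [← mul_one c, ← C_mul_monomial, map_mul, ← zero_add (Finsupp.weight _ _)]
  exact reesDegree_mul_mem (hC c) h1

theorem reesPresentation_mem {f : MvPolynomial (Fin n ⊕ reesGenerators I) K} {a : ℤ × ℤ}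
    (hf : IsWeightedHomogeneous (reesWeight I) f a) : reesPresentation I f ∈ reesDegree I a := by
  rw [f.as_sum, map_sum]
  refine Finset.sum_induction _ (· ∈ reesDegree I a) (fun _ _ => reesDegree_add_mem)
    (reesDegree_zero_mem a) fun d hd => ?_
  rw [← hf (mem_support_iff.1 hd)]
  exact reesPresentation_monomial_mem d _

/-- The projection of the symbolic Rees algebra onto its component of bidegree `c`. -/
def reesProj (hI : ∀ k, IsGradedIdeal (symbolicPower I k)) (c : ℤ × ℤ) :
    symbolicRees I →+ symbolicRees I where
  toFun x := ⟨if 0 ≤ c.2 then Polynomial.monomial c.2.toNat (weightedHomogeneousComponent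
      (fun _ : Fin n => (1 : ℤ)) c.1 ((x : Polynomial (MvPolynomial (Fin n) K)).coeff c.2.toNat))
      else 0, fun k => by
    split_ifs
    · rw [Polynomial.coeff_monomial]
      split_ifs with h
      · subst h
        exact hI _ _ _ (x.2 _)
      · exact zero_mem _
    · simp⟩
  map_zero' := by ext1; simp
  map_add' x y := by
    ext1
    simp only [Subalgebra.coe_add, Polynomial.coeff_add, map_add]
    split_ifs <;> simp

theorem coeff_reesProj (hI : ∀ k, IsGradedIdeal (symbolicPower I k)) (c : ℤ × ℤ)
    (x : symbolicRees I) (k : ℕ) :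
    (reesProj hI c x : Polynomial (MvPolynomial (Fin n) K)).coeff k =
      if (k : ℤ) = c.2 then weightedHomogeneousComponent (fun _ : Fin n => (1 : ℤ)) c.1
        ((x : Polynomial (MvPolynomial (Fin n) K)).coeff k) else 0 := by
  simp only [reesProj, AddMonoidHom.coe_mk, ZeroHom.coe_mk]
  by_cases hc : 0 ≤ c.2
  · rw [if_pos hc, Polynomial.coeff_monomial]
    by_cases hk : c.2.toNat = k
    · rw [if_pos hk, if_pos (by omega), hk]
    · rw [if_neg hk, if_neg (by omega)]
  · rw [if_neg hc, if_neg (by omega), Polynomial.coeff_zero]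

theorem gradingProj_rees (hI : ∀ k, IsGradedIdeal (symbolicPower I k)) :
    GradingProj (K := K) (reesWeight I) (reesDegree I) (reesProj hI) where
  smul_mem hf hm := reesDegree_mul_mem (reesPresentation_mem hf) hm
  proj_of_mem {c m} hm := by
    ext1
    refine Polynomial.ext fun k => ?_
    rw [coeff_reesProj]
    split_ifs with hk
    · exact (hm k).1.weightedHomogeneousComponent_same
    · exact ((hm k).2 hk).symm
  proj_of_ne {c b m} hm hab := by
    ext1
    refine Polynomial.ext fun k => ?_
    rw [coeff_reesProj]
    split_ifs with hk
    · by_cases hk' : (k : ℤ) = c.2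
      · exact (hm k).1.weightedHomogeneousComponent_ne _
          fun h => hab (Prod.ext h (hk.symm.trans hk'))
      · rw [(hm k).2 hk', map_zero]
        rfl
    · rfl
  proj_mem c m k := by
    rw [coeff_reesProj]
    split_ifs with hk
    · exact ⟨weightedHomogeneousComponent_isWeightedHomogeneous _ _, fun h => absurd hk h⟩
    · exact ⟨isWeightedHomogeneous_zero K _ _, fun _ => rfl⟩

theorem exists_eq_mapDomain_add_mapDomain {α β : Type*} (d : α ⊕ β →₀ ℕ) :
    ∃ (d₁ : α →₀ ℕ) (d₂ : β →₀ ℕ), d = d₁.mapDomain Sum.inl + d₂.mapDomain Sum.inr := by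
  classical
  induction d using Finsupp.induction_linear with
  | zero => exact ⟨0, 0, by simp⟩
  | add d d' h h' =>
    obtain ⟨a, b, rfl⟩ := h
    obtain ⟨a', b', rfl⟩ := h'
    exact ⟨a + a', b + b', by simp only [Finsupp.mapDomain_add]; abel⟩
  | single s m =>
    cases s with
    | inl i => exact ⟨Finsupp.single i m, 0, by simp⟩
    | inr j => exact ⟨0, Finsupp.single j m, by simp⟩

theorem weight_reesWeight_inl (d : Fin n →₀ ℕ) :
    Finsupp.weight (reesWeight I) (d.mapDomain Sum.inl) = ((d.degree : ℤ), 0) := by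
  induction d using Finsupp.induction_linear with
  | zero => simp [Prod.ext_iff]
  | add a b ha hb => rw [Finsupp.mapDomain_add, map_add, ha, hb]; simp
  | single i m => simp [Finsupp.weight_single, reesWeight]

theorem weight_reesWeight_inr (d : reesGenerators I →₀ ℕ) :
    Finsupp.weight (reesWeight I) (d.mapDomain Sum.inr) =
      (((d.sum fun g m => m * g.1.1.degree : ℕ) : ℤ), ((d.sum fun g m => m * g.1.2 : ℕ) : ℤ)) := by
  induction d using Finsupp.induction_linear with
  | zero => simp [Prod.ext_iff]
  | add a b ha hb =>
    rw [Finsupp.mapDomain_add, map_add, ha, hb,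
      Finsupp.sum_add_index' (by simp) (by intros; rw [add_mul]),
      Finsupp.sum_add_index' (by simp) (by intros; rw [add_mul])]
    simp
  | single g m => simp [Finsupp.weight_single, reesWeight]

theorem weight_reesWeight_snd_nonneg (d : Fin n ⊕ reesGenerators I →₀ ℕ) :
    0 ≤ (Finsupp.weight (reesWeight I) d).2 := by
  obtain ⟨d₁, d₂, rfl⟩ := exists_eq_mapDomain_add_mapDomain d
  rw [map_add, weight_reesWeight_inl, weight_reesWeight_inr, Prod.snd_add, zero_add]
  exact Int.natCast_nonneg _

theorem isWeightedHomogeneous_rename_inl {f : MvPolynomial (Fin n) K} {a : ℤ}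
    (hf : IsWeightedHomogeneous (fun _ : Fin n => (1 : ℤ)) f a) :
    IsWeightedHomogeneous (reesWeight I) (rename Sum.inl f) (a, 0) := by
  intro d hd
  obtain ⟨d', rfl, hd'⟩ := coeff_rename_ne_zero _ _ _ hd
  rw [weight_reesWeight_inl, ← hf hd', weight_one_int]

/-- The shifts of a minimal bigraded resolution of the symbolic Rees algebra are nonnegative in the
second component. -/
theorem GradedFreeResolution.IsMinimal.shift_snd_nonneg
    {F : GradedFreeResolution (K := K) (reesWeight I) (reesDegree I)} (hF : F.IsMinimal)
    (i : ℕ) (j : Fin (F.rank i)) : 0 ≤ (F.shift i j).2 := by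
  -- By minimality a basis element is not a boundary, so by exactness it is not killed by the
  -- outgoing map. But the target of that map vanishes in negative second degree.
  have hne : ∀ i (j : Fin (F.rank i)), (Pi.single j 1 : Fin (F.rank i) → _) ∉
      Set.range (F.d i) := by
    rintro i j ⟨v, hv⟩
    have := hF i v j
    rw [hv, Pi.single_eq_same, mem_span_range_X_iff] at this
    simp at this
  induction i with
  | zero =>
    by_contra! hlt
    refine hne 0 j ((F.exact_zero _).1 ?_)
    ext1
    refine Polynomial.ext fun k => ?_
    exact (F.ε_homogeneous j k).2 (by omega)
  | succ i ih =>
    by_contra! hlt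
    refine hne (i + 1) j ((F.exact_succ i _).1 ?_)
    ext1 l
    refine (F.d_homogeneous i j l).eq_zero_of_no_monomials fun d hd => ?_
    have h1 := weight_reesWeight_snd_nonneg d
    have h2 := ih l
    rw [hd, Prod.snd_sub] at h1
    omega

end Rees

attribute [local instance] reesModule reesSMul

/-! ## Restriction of scalars from `T` to `S` -/

section RestrictScalars

variable {K : Type*} [Field K] {n : ℕ} {I : Ideal (MvPolynomial (Fin n) K)}

/-- `K[x, y]` as an algebra over `K[x]`. -/
@[reducible]
def sumAlgebra (K : Type*) [Field K] (n : ℕ) (τ : Type*) :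
    Algebra (MvPolynomial (Fin n) K) (MvPolynomial (Fin n ⊕ τ) K) :=
  (rename Sum.inl : MvPolynomial (Fin n) K →ₐ[K] MvPolynomial (Fin n ⊕ τ) K).toRingHom.toAlgebra

attribute [local instance] sumAlgebra

/-- Lets a free `T`-resolution serve as a projective resolution over `S`: `T` is `S[y]`, free on the
monomials in `y`. -/
theorem free_sumAlgebra (τ : Type*) :
    Module.Free (MvPolynomial (Fin n) K) (MvPolynomial (Fin n ⊕ τ) K) := by
  let e : MvPolynomial (Fin n ⊕ τ) K ≃ₐ[K] MvPolynomial τ (MvPolynomial (Fin n) K) :=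
    (renameEquiv K (Equiv.sumComm _ _)).trans (sumAlgEquiv K τ (Fin n))
  have he : ∀ f : MvPolynomial (Fin n) K, e (rename Sum.inl f) = C f := by
    intro f
    have : e.toAlgHom.comp (rename Sum.inl) =
        IsScalarTower.toAlgHom K (MvPolynomial (Fin n) K)
          (MvPolynomial τ (MvPolynomial (Fin n) K)) := by
      ext1 i
      simp [e, algebraMap_eq]
    exact DFunLike.congr_fun this f
  let e' : MvPolynomial τ (MvPolynomial (Fin n) K) ≃ₗ[MvPolynomial (Fin n) K]
      MvPolynomial (Fin n ⊕ τ) K :=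
    LinearEquiv.symm
      { e.toAddEquiv with
        map_smul' := fun f x => by
          change e (rename Sum.inl f * x) = f • e x
          rw [map_mul, he, C_mul'] }
  exact Module.Free.of_equiv e'

theorem reesPresentation_rename_inl (f : MvPolynomial (Fin n) K) :
    reesPresentation I (rename Sum.inl f) =
      algebraMap (MvPolynomial (Fin n) K) (symbolicRees I) f := by
  have : (reesPresentation I).comp (rename Sum.inl) =
      IsScalarTower.toAlgHom K (MvPolynomial (Fin n) K) (symbolicRees I) := by
    ext1 i
    simp [reesPresentation]
  exact DFunLike.congr_fun this f

theorem isScalarTower_rees : IsScalarTower (MvPolynomial (Fin n) K)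
    (MvPolynomial (Fin n ⊕ reesGenerators I) K) (symbolicRees I) where
  smul_assoc f g x := by
    change reesPresentation I (rename Sum.inl f * g) * x = f • (reesPresentation I g * x)
    rw [map_mul, reesPresentation_rename_inl, Algebra.smul_def, mul_assoc]

/-- The inclusion of `I^(k)` as the component of degree `k` of the symbolic Rees algebra. -/
def toRees (I : Ideal (MvPolynomial (Fin n) K)) (k : ℕ) :
    symbolicPower I k →ₗ[MvPolynomial (Fin n) K] symbolicRees I where
  toFun f := ⟨Polynomial.monomial k f.1, fun l => by
    rw [Polynomial.coeff_monomial]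
    split_ifs with h
    · exact h ▸ f.2
    · exact zero_mem _⟩
  map_add' f g := by ext1; simp
  map_smul' f g := by ext1; simp [Polynomial.smul_monomial]

/-- The projection of the symbolic Rees algebra to its component of degree `k`. -/
def ofRees (I : Ideal (MvPolynomial (Fin n) K)) (k : ℕ) :
    symbolicRees I →ₗ[MvPolynomial (Fin n) K] symbolicPower I k where
  toFun x := ⟨(x : Polynomial (MvPolynomial (Fin n) K)).coeff k, x.2 k⟩
  map_add' f g := by ext1; simp
  map_smul' f g := by ext1; simp

theorem ofRees_toRees (k : ℕ) (f : symbolicPower I k) : ofRees I k (toRees I k f) = f := by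
  ext1
  simp [ofRees, toRees]

theorem toRees_mem {k : ℕ} {a : ℤ} {f : symbolicPower I k} (hf : f ∈ idealDegree _ a) :
    toRees I k f ∈ reesDegree I (a, k) := by
  intro l
  change IsWeightedHomogeneous _ ((Polynomial.monomial k f.1).coeff l) _ ∧
    (_ → (Polynomial.monomial k f.1).coeff l = 0)
  rw [Polynomial.coeff_monomial]
  split_ifs with h
  · exact ⟨hf, fun h' => absurd (by simp [h]) h'⟩
  · exact ⟨isWeightedHomogeneous_zero K _ _, fun _ => rfl⟩

/-- A homogeneous element of bidegree `(a, k)` of a bigraded free `T`-module with shifts `(a', b')`,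
`a' ≤ e` and `b' ≥ 0`, lies in the submodule generated by the multiples of the `x_i` if
`a - e > d(I, k)`. -/
theorem mem_smul_top_of_dMax_lt {r : ℕ} {s : Fin r → ℤ × ℤ} {e a : ℤ} {k : ℕ}
    (hs : ∀ j, (s j).1 ≤ e ∧ 0 ≤ (s j).2) (ha : dMax I k < (((a - e : ℤ) : ℝ) : EReal))
    {y : Fin r → MvPolynomial (Fin n ⊕ reesGenerators I) K}
    (hy : y ∈ freeDegree K (reesWeight I) s (a, (k : ℤ))) :
    y ∈ Ideal.span (Set.range (X : Fin n → MvPolynomial (Fin n) K)) •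
      (⊤ : Submodule (MvPolynomial (Fin n) K)
        (Fin r → MvPolynomial (Fin n ⊕ reesGenerators I) K)) := by
  classical
  rw [← Finset.univ_sum_single y]
  refine Submodule.sum_mem _ fun j _ => ?_
  rw [(y j).as_sum]
  have hsum : (Pi.single j (∑ d ∈ (y j).support, monomial d (coeff d (y j))) :
      Fin r → MvPolynomial (Fin n ⊕ reesGenerators I) K) =
      ∑ d ∈ (y j).support, Pi.single j (monomial d (coeff d (y j))) :=
    map_sum (AddMonoidHom.single (fun _ => MvPolynomial (Fin n ⊕ reesGenerators I) K) j) _ _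
  rw [hsum]
  refine Submodule.sum_mem _ fun d hd => ?_
  have hw := hy j (mem_support_iff.1 hd)
  obtain ⟨d₁, d₂, rfl⟩ := exists_eq_mapDomain_add_mapDomain d
  rw [map_add, weight_reesWeight_inl, weight_reesWeight_inr, Prod.ext_iff] at hw
  simp only [Prod.fst_add, Prod.snd_add, Prod.fst_sub, Prod.snd_sub, zero_add] at hw
  -- Shifts are nonnegative in the second component, so the exponent `d₂` of the `y`-part competes
  -- in `dMax I k`. With the shift bounded by `e`, the first degree `a` is reached only if some
  -- `x_i` occurs.
  have hq : (d₂.sum fun g m => m * g.1.2) ≤ k := by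
    have := (hs j).2
    omega
  have hD : ((d₂.sum fun g m => m * g.1.1.degree : ℕ) : EReal) ≤ dMax I k :=
    le_iSup₂_of_le d₂ hq le_rfl
  have hlt : ((d₂.sum fun g m => m * g.1.1.degree : ℕ) : ℤ) < a - e := by
    have := hD.trans_lt ha
    rw [← EReal.coe_natCast, EReal.coe_lt_coe_iff] at this
    exact_mod_cast this
  have hd₁ : d₁ ≠ 0 := by
    rintro rfl
    have := (hs j).1
    simp only [map_zero, Nat.cast_zero, zero_add] at hw
    omega
  obtain ⟨i, hi⟩ := Finsupp.ne_iff.1 hd₁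
  have hle : Finsupp.single i 1 ≤ d₁ := by
    rw [Finsupp.single_le_iff]
    exact Nat.pos_of_ne_zero hi
  obtain ⟨d', rfl⟩ := exists_add_of_le hle
  set c := coeff _ (y j)
  have hX : (Pi.single j (monomial ((Finsupp.single i 1 + d').mapDomain Sum.inl +
      d₂.mapDomain Sum.inr) c) : Fin r → MvPolynomial (Fin n ⊕ reesGenerators I) K) =
      (X i : MvPolynomial (Fin n) K) •
        Pi.single j (monomial (d'.mapDomain Sum.inl + d₂.mapDomain Sum.inr) c) := by
    rw [← Pi.single_smul]
    congr 1
    change _ = rename Sum.inl (X i) * _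
    rw [rename_X, X, monomial_mul, one_mul, Finsupp.mapDomain_add, Finsupp.mapDomain_single,
      add_assoc]
  rw [hX]
  exact Submodule.smul_mem_smul (Ideal.subset_span ⟨i, rfl⟩) trivial

/-- If `reg_x R_s(I) = 0`, then `reg I^(k) ≤ d(I, k)`. -/
theorem reg_symbolicPower_le_dMax (hI : ∀ k, IsGradedIdeal (symbolicPower I k))
    (hreg : regX I = 0) (k : ℕ) : reg (symbolicPower I k) ≤ dMax I k := by
  have hle : ∀ i, ∀ c ∈ reesShifts I i, c.1 ≤ i := by
    intro i c hc
    have : (((c.1 - i : ℤ) : ℝ) : EReal) ≤ regX I :=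
      le_iSup_of_le i (le_iSup₂_of_le c hc le_rfl)
    rw [hreg, ← EReal.coe_zero, EReal.coe_le_coe_iff] at this
    have : c.1 - i ≤ 0 := by exact_mod_cast this
    omega
  -- Without a minimal resolution `regX I` would be the empty supremum `⊥`, not 0. So the resolution
  -- comes from `hreg`, without proving `R_s(I)` finitely generated.
  have hex : ∃ F : GradedFreeResolution (K := K) (reesWeight I) (reesDegree I), F.IsMinimal := by
    by_contra! hno
    have : regX I = ⊥ := by
      simp only [regX, iSup_eq_bot]
      rintro i c ⟨F, hF, -⟩
      exact absurd hF (hno F)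
    rw [hreg] at this
    exact EReal.zero_ne_bot this
  obtain ⟨F, hF⟩ := hex
  have hF1 : ∀ i j, (F.shift i j).1 ≤ i := fun i j => hle i _ ⟨F, hF, j, rfl⟩
  have := isScalarTower_rees (I := I)
  have := free_sumAlgebra (K := K) (n := n) (reesGenerators I)
  refine reg_le ?_
  rintro i _ ⟨F', hF', j, rfl⟩
  -- Fixing the second degree at `k` grades the `T`-resolution over `S`, the variables `x_i` having
  -- bidegree `(1, 0)`.
  obtain ⟨y, hy, hy'⟩ := hF'.exists_notMem
    (G := fun i => Fin (F.rank i) → MvPolynomial (Fin n ⊕ reesGenerators I) K)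
    (fun i => (F.d i).restrictScalars (MvPolynomial (Fin n) K))
    (F.ε.restrictScalars (MvPolynomial (Fin n) K)) F.exact_zero F.exact_succ
    (fun i a => freeDegree K (reesWeight I) (F.shift i) (a, (k : ℤ)))
    (fun i a r y hy => (gradingProj_free _).sum_mem _ _ fun j _ => hy j)
    (fun i a b f hf y hy => by
      have := (gradingProj_free (K := K) _).smul_mem (isWeightedHomogeneous_rename_inl hf) hy
      rw [Prod.mk_add_mk, zero_add] at this
      exact this)
    (toRees I k) (ofRees I k) (ofRees_toRees k)
    (fun a m hm => (gradingProj_rees hI).exists_homogeneous_preimage F.ε_homogeneous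
      (toRees_mem hm) (F.ε_surjective _))
    (fun i a y hy hy' => (gradingProj_free _).exists_homogeneous_preimage
      (fun l => F.d_homogeneous i l) hy hy') i j
  by_contra! hlt
  exact hy' (mem_smul_top_of_dMax_lt
    (fun l => ⟨hF1 i l, hF.shift_snd_nonneg i l⟩) hlt hy)

end RestrictScalars

end SymbolicReg

end

/-! ### Comparison of symbolic and ordinary powers -/

theorem theorem1p2 {K : Type*} [Field K] {n : ℕ} (I : Ideal (MvPolynomial (Fin n) K))
    (hI : SymbolicReg.IsMinimalIntersectionType I) :
    (∀ u ∈ SymbolicReg.minimalGenerators I, ∀ k : ℕ, 1 ≤ k →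
      u ^ k ∈ SymbolicReg.minimalGenerators (SymbolicReg.symbolicPower I k)) ∧
    (∀ k : ℕ, 1 ≤ k →
      SymbolicReg.reg (SymbolicReg.symbolicPower I k) ≥
        SymbolicReg.finalDegree (SymbolicReg.symbolicPower I k) ∧
      SymbolicReg.finalDegree (SymbolicReg.symbolicPower I k) ≥
        SymbolicReg.finalDegree I * (k : EReal)) ∧
    (SymbolicReg.HasLinearPowers I → ∀ k : ℕ, 1 ≤ k →
      SymbolicReg.reg (SymbolicReg.symbolicPower I k) ≥ SymbolicReg.reg (I ^ k)) ∧
    (SymbolicReg.HasLinearPowers I → SymbolicReg.regX I = 0 →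
      (∀ k : ℕ, 1 ≤ k → SymbolicReg.dMax I k = SymbolicReg.finalDegree I * (k : EReal)) →
      ∀ k : ℕ, 1 ≤ k →
        SymbolicReg.reg (SymbolicReg.symbolicPower I k) = SymbolicReg.reg (I ^ k)) := by
  have hgr := hI.isGradedIdeal_symbolicPower
  have hgrI : SymbolicReg.IsGradedIdeal I := SymbolicReg.symbolicPower_one I ▸ hgr 1
  have hb : ∀ k : ℕ, 1 ≤ k → SymbolicReg.finalDegree I * (k : EReal) ≤
      SymbolicReg.reg (SymbolicReg.symbolicPower I k) := fun k hk =>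
    (hI.finalDegree_mul_le hk).trans (hgr k).finalDegree_le_reg
  have hc : SymbolicReg.HasLinearPowers I → ∀ k : ℕ, 1 ≤ k →
      SymbolicReg.reg (SymbolicReg.symbolicPower I k) ≥ SymbolicReg.reg (I ^ k) := by
    intro hlin k hk
    -- The zero ideal has no generating degree, but there the two powers coincide.
    rcases eq_or_ne I ⊥ with rfl | h0
    · rw [SymbolicReg.symbolicPower_bot hk]
    · rw [hlin.reg_pow hgrI h0 hk]
      exact hb k hk
  refine ⟨fun u hu k _ => hI.pow_mem_minimalGenerators hu k,
    fun k hk => ⟨(hgr k).finalDegree_le_reg, hI.finalDegree_mul_le hk⟩, hc,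
    fun hlin hreg hd k hk => ?_⟩
  rcases eq_or_ne I ⊥ with rfl | h0
  · rw [SymbolicReg.symbolicPower_bot hk]
  · refine le_antisymm ?_ (hc hlin k hk)
    rw [hlin.reg_pow hgrI h0 hk, ← hd k hk]
    exact SymbolicReg.reg_symbolicPower_le_dMax hgr hreg k
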